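/- Let $V=\{1,\dots,n\}$, let $G=(V,E)$ be a directed graph (loops allowed), and let $\mu$ be a probability distribution on $V$ with $\mu_i>0$ for all $i\in V$. For each $i\in V$ let $\Sigma_i$ be the set of probability vectors $\pi_i=(\pi_{ij})_{j\in V}$ with $\pi_{ij}=0$ whenever $(i,j)\notin E$, let $\Xi_i\subseteq\Sigma_i$ be an arbitrary subset, and let $\Xi=\prod_{i\in V}\Xi_i$. A profile $\pi\in\Xi$ is identified with the stochastic matrix $(\pi_{ij})$. In the constrained buck-holding game, player $i\in V$ chooses $\pi_i\in\Xi_i$ and maximizes the payoff $$c_i(\pi)=\mathbb E_{\mu,\pi}\Big[\lim_{T\to\infty}\frac1T\sum_{t=1}^T \mathbf 1_{\{X_t=i\}}\Big],$$ where $(X_t)_{t\ge 0}$ is the Markov chain on $V$ with initial distribution $\mu$ and transition matrix $\pi$. For a profile $\pi$, let $R^1_\pi,\dots,R^{m(\pi)}_\pi$ be the recurrent classes of the chain with transition matrix $\pi$ (the closed communicating classes), let $T^\ell_\pi$ be the set of all $j\in V$ such that the chain started at $j$ reaches $R^\ell_\pi$ with probability $1$, and let $$\Omega^\ell(\pi)=\sum_{i\in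 T^\ell_\pi}\ \sum_{\tau}\ \prod_{(j,k)\in\tau}\pi_{jk},$$ where $\tau$ ranges over the $i$-rooted spanning trees of the complete directed graph on $T^\ell_\pi$, that is, the acyclic edge sets $\tau\subseteq T^\ell_\pi\times T^\ell_\pi$ in which $i$ has out-degree $0$ and every other vertex of $T^\ell_\pi$ has out-degree $1$. Put $$\Psi(\pi)=\sum_{\ell=1}^{m(\pi)}\big(n-\Omega^\ell(\pi)\big).$$ Then $\Psi$ is a generalized ordinal potential of the game: for every $\pi\in\Xi$, every $i\in V$ and every $\pi_i'\in\Xi_i$, writing $\pi'=(\pi_i',\pi_{-i})$, $$c_i(\pi')>c_i(\pi)\ \Longrightarrow\ \Psi(\pi')>\Psi(\pi).$$ -/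

import Mathlib

open Filter Topology MeasureTheory ProbabilityTheory

noncomputable section

namespace BuckHolding

/-! ### Games with payoffs -/

/-- `Ψ` is a generalized ordinal potential of the game in which player `i` has strategy set `S i`
and maximizes the payoff `c i`: every profitable unilateral deviation strictly increases `Ψ`. -/
def IsGeneralizedOrdinalPotential {V : Type*} [DecidableEq V] {S : V → Type*}
    (c : V → (∀ i, S i) → ℝ) (Ψ : (∀ i, S i) → ℝ) : Prop :=
  ∀ (s : ∀ i, S i) (i : V) (s' : S i),
    c i s < c i (Function.update s i s') → Ψ s < Ψ (Function.update s i s')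

/-! ### The Markov chain followed by the buck -/

/-- A strategy profile, i.e. a stochastic matrix: row `i` is the probability vector according to
which player `i` passes the buck. -/
abbrev Profile (n : ℕ) : Type := Fin n → stdSimplex ℝ (Fin n)

/-- The probability measure with mass function `p`. -/
def massMeasure {n : ℕ} (p : stdSimplex ℝ (Fin n)) : Measure (Fin n) :=
  ∑ j, ENNReal.ofReal (p j) • Measure.dirac j

instance isProbabilityMeasure_massMeasure {n : ℕ} (p : stdSimplex ℝ (Fin n)) :
    IsProbabilityMeasure (massMeasure p) := by
  constructor
  have h : ∑ j, p j = 1 := p.2.2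
  simp only [massMeasure, Measure.coe_finsetSum, Finset.sum_apply, Measure.smul_apply,
    measure_univ, smul_eq_mul, mul_one]
  rw [← ENNReal.ofReal_sum_of_nonneg (f := fun j => p j) (fun j _ => p.2.1 j), h, ENNReal.ofReal_one]

/-- The one-step transition kernel with transition matrix `π`. -/
def stepKernel {n : ℕ} (π : Profile n) : Kernel (Fin n) (Fin n) :=
  Kernel.ofFunOfCountable fun i => massMeasure (π i)

instance isMarkovKernel_stepKernel {n : ℕ} (π : Profile n) : IsMarkovKernel (stepKernel π) :=
  ⟨fun i => isProbabilityMeasure_massMeasure (π i)⟩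

/-- The conditional law of the position at time `t + 1` given the positions up to time `t`:
it depends only on the position at time `t`, through the transition matrix `π`. -/
def historyKernel {n : ℕ} (π : Profile n) (t : ℕ) :
    Kernel (Finset.Iic t → Fin n) (Fin n) :=
  (stepKernel π).comap (fun x => x ⟨t, Finset.mem_Iic.mpr le_rfl⟩) (measurable_pi_apply _)

instance isMarkovKernel_historyKernel {n : ℕ} (π : Profile n) (t : ℕ) :
    IsMarkovKernel (historyKernel π t) := by
  unfold historyKernel; infer_instance

/-- The law, on the space of trajectories `ℕ → Fin n`, of the time-homogeneous Markov chain with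
initial distribution `μ` and transition matrix `π`. -/
def chainLaw {n : ℕ} (μ : stdSimplex ℝ (Fin n)) (π : Profile n) : Measure (ℕ → Fin n) :=
  Kernel.trajMeasure (X := fun _ => Fin n) (massMeasure μ) (historyKernel π)

/-- The fraction of times `1, …, T` at which player `i` has the buck along the trajectory `x`. -/
def frequency {n : ℕ} (i : Fin n) (x : ℕ → Fin n) (T : ℕ) : ℝ :=
  (1 / (T : ℝ)) * ∑ t ∈ Finset.Icc 1 T, if x t = i then 1 else 0

/-- The payoff of player `i`: the expected asymptotic frequency of times at which she has the
buck. -/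
def payoff {n : ℕ} (μ : stdSimplex ℝ (Fin n)) (i : Fin n) (π : Profile n) : ℝ :=
  ∫ x, limUnder atTop (frequency i x) ∂(chainLaw μ π)

/-! ### Recurrent classes and their transient closures -/

/-- `k` can be reached from `j` in the graph whose edges are the pairs with positive transition
probability. -/
def Reaches {n : ℕ} (π : Profile n) : Fin n → Fin n → Prop :=
  Relation.ReflTransGen fun j k => 0 < π j k

/-- A recurrent class: a nonempty set of vertices which can all be reached from one another, and
from which no other vertex can be reached. -/
def IsRecurrentClass {n : ℕ} (π : Profile n) (R : Finset (Fin n)) : Prop :=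
  R.Nonempty ∧ ∀ j ∈ R, ∀ k, Reaches π j k ↔ k ∈ R

open Classical in
/-- The set of all recurrent classes. -/
def recurrentClasses {n : ℕ} (π : Profile n) : Finset (Finset (Fin n)) :=
  Finset.univ.filter (IsRecurrentClass π)

/-- The probability that the chain started at `j` ever visits `R`. -/
def absorptionProb {n : ℕ} (π : Profile n) (j : Fin n) (R : Finset (Fin n)) : ℝ :=
  (chainLaw (stdSimplex.vertex j) π).real {x | ∃ T, x T ∈ R}

open Classical in
/-- The transient closure of `R`: the vertices from which `R` is reached with probability one. -/
def transientClosure {n : ℕ} (π : Profile n) (R : Finset (Fin n)) : Finset (Fin n) :=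
  Finset.univ.filter fun j => absorptionProb π j R = 1

/-! ### Spanning trees and their weights -/

/-- The edge set `τ` is an `i`-rooted spanning tree in the complete graph on the vertex set `T`:
`i` has out-degree `0`, every other vertex of `T` has out-degree `1`, and there is no cycle. -/
structure IsRootedSpanningTree {n : ℕ} (T : Finset (Fin n)) (i : Fin n)
    (τ : Finset (Fin n × Fin n)) : Prop where
  root_mem : i ∈ T
  edges_subset : τ ⊆ T ×ˢ T
  root_out : ∀ k, (i, k) ∉ τ
  out_unique : ∀ j ∈ T, j ≠ i → ∃! k, (j, k) ∈ τ
  acyclic : ∀ j, ¬ Relation.TransGen (fun a b => (a, b) ∈ τ) j j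

open Classical in
/-- The set of `i`-rooted spanning trees in the complete graph on the vertex set `T`. -/
def rootedSpanningTrees {n : ℕ} (T : Finset (Fin n)) (i : Fin n) :
    Finset (Finset (Fin n × Fin n)) :=
  Finset.univ.filter (IsRootedSpanningTree T i)

/-- The weight of an edge set: the product of the transition probabilities of its edges. -/
def weight {n : ℕ} (π : Profile n) (τ : Finset (Fin n × Fin n)) : ℝ :=
  ∏ e ∈ τ, π e.1 e.2

/-- The total weight of the rooted spanning trees, over all roots, on the vertex set `T`. -/
def treeWeight {n : ℕ} (π : Profile n) (T : Finset (Fin n)) : ℝ :=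
  ∑ i ∈ T, ∑ τ ∈ rootedSpanningTrees T i, weight π τ

/-- The tree-weight potential: the sum, over the recurrent classes `R`, of `n` minus the total tree
weight on the transient closure of `R`. -/
def potential {n : ℕ} (π : Profile n) : ℝ :=
  ∑ R ∈ recurrentClasses π, ((n : ℝ) - treeWeight π (transientClosure π R))

end BuckHolding

end

/-! Only row `i` changes, so compare both profiles with one reference chain `Q`, in which `i` is
absorbing. Let `u j` be the probability that `Q` started at `j` hits `i`. If `i` is transient, its
payoff is 0. If `i` is recurrent, its payoff is `(∑ j, μ j * u j) / m`, with `m` the mean return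
time to `i`; the numerator is positive and independent of row `i`. Both formulas come from
`payoff_eq_of_poisson`: writing the indicator of `i` as a harmonic function `h` plus a coboundary `g
- πg`, the martingale strong law shows that the frequency of `i` has the same limit as `h (X_T)`,
whose mean is constant in `T`.

The Markov chain tree theorem on the transient closure `T` of the class of `i` gives `m * w = Ω(T)`,
where `w` is the weight of the trees rooted at `i` (`returnTime_mul_treeMapWeight`). These trees use
no edge leaving `i`, so `w` does not see row `i`; nor does `T`, as long as `i` stays recurrent.
Hence a larger payoff means a smaller `m`, a smaller `Ω(T)` and a larger potential, the terms of the
other classes being unchanged.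

The other profitable case is that `i` turns from transient to recurrent. A new class `C` appears,
and the term of at most one old class `R` changes. For disjoint closures the new weights satisfy
`Ω(C) + Ω(R) ≤ n`, while the old weight of `R` is positive, so the potential rises
(`potential_lt_of_becomes_recurrent`). If `i` ends up transient, its payoff is 0 and nothing was
gained. -/

noncomputable section

namespace BuckHolding

/-! ### The transition operator and the Markov property. -/

variable {n : ℕ}

/-- The operator `f ↦ (i ↦ ∑ j, π i j * f j)` associated with the transition matrix `π`. -/
def stepMean (π : Profile n) : (Fin n → ℝ) →ₗ[ℝ] (Fin n → ℝ) :=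
  Matrix.mulVecLin (Matrix.of fun i j => π i j)

lemma stepMean_apply (π : Profile n) (f : Fin n → ℝ) (i : Fin n) :
    stepMean π f i = ∑ j, π i j * f j := rfl

lemma prob_nonneg (p : stdSimplex ℝ (Fin n)) (j : Fin n) : 0 ≤ p j := p.2.1 j

lemma sum_prob (p : stdSimplex ℝ (Fin n)) : ∑ j, p j = 1 := p.2.2

lemma integral_massMeasure (p : stdSimplex ℝ (Fin n)) (f : Fin n → ℝ) :
    ∫ j, f j ∂(massMeasure p) = ∑ j, p j * f j := by
  rw [massMeasure, integral_finsetSum_measure]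
  · refine Finset.sum_congr rfl fun j _ => ?_
    rw [integral_smul_measure, integral_dirac, ENNReal.toReal_ofReal (prob_nonneg p j), smul_eq_mul]
  · intro j _
    exact (integrable_dirac (by simp)).smul_measure (by simp)

lemma integral_historyKernel (π : Profile n) (t : ℕ) (y : Finset.Iic t → Fin n) (f : Fin n → ℝ) :
    ∫ j, f j ∂(historyKernel π t y) = stepMean π f (y ⟨t, Finset.mem_Iic.mpr le_rfl⟩) := by
  rw [historyKernel, Kernel.comap_apply, stepMean_apply, ← integral_massMeasure]
  rfl

instance isProbabilityMeasure_chainLaw (μ : stdSimplex ℝ (Fin n)) (π : Profile n) :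
    IsProbabilityMeasure (chainLaw μ π) := by
  unfold chainLaw; infer_instance

/-- The canonical filtration of the space of trajectories. -/
abbrev history (n : ℕ) : Filtration ℕ (MeasurableSpace.pi (X := fun _ : ℕ => Fin n)) :=
  Filtration.piLE (X := fun _ : ℕ => Fin n)

lemma integral_coordinate_zero (μ : stdSimplex ℝ (Fin n)) (π : Profile n) (f : Fin n → ℝ) :
    ∫ x, f (x 0) ∂(chainLaw μ π) = ∑ j, μ j * f j := by
  have h0 : (chainLaw μ π).map (fun x => x 0) = massMeasure μ := by
    have hev : (fun x : ℕ → Fin n => x 0) =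
        (fun y : Finset.Iic 0 → Fin n => y ⟨0, Finset.mem_Iic.mpr le_rfl⟩) ∘
          Preorder.frestrictLe (π := fun _ => Fin n) 0 := rfl
    rw [chainLaw, Kernel.trajMeasure, hev, ← Measure.map_map (by fun_prop) (by fun_prop),
      Measure.map_comp _ _ (by fun_prop), Kernel.traj_map_frestrictLe, Kernel.partialTraj_self,
      Measure.id_comp, Measure.map_map (by fun_prop) (by fun_prop)]
    exact Measure.map_id
  rw [← integral_massMeasure, ← h0, integral_map (measurable_pi_apply 0).aemeasurable
    (by fun_prop)]

/-- This is the Markov property: `z` factors through the path up to time `t`, and the joint law of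
that path and the next position is a composition-product with `historyKernel`. -/
lemma integral_history_mul (μ : stdSimplex ℝ (Fin n)) (π : Profile n) (t : ℕ)
    (z : (ℕ → Fin n) → ℝ) (hz : Measurable[history n t] z) (f : Fin n → ℝ) :
    ∫ x, z x * f (x (t + 1)) ∂(chainLaw μ π) = ∫ x, z x * stepMean π f (x t) ∂(chainLaw μ π) := by
  rw [history, Filtration.piLE_eq_comap_frestrictLe] at hz
  obtain ⟨w, -, rfl⟩ := hz.exists_eq_measurable_comp
  have key := Kernel.map_frestrictLe_trajMeasure_compProd_eq_map_trajMeasure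
    (X := fun _ => Fin n) (μ₀ := massMeasure μ) (κ := historyKernel π) (a := t)
  have h1 : ∫ x, w (Preorder.frestrictLe t x) * f (x (t + 1)) ∂(chainLaw μ π) =
      ∫ y, w y.1 * f y.2 ∂((chainLaw μ π).map fun x => (Preorder.frestrictLe t x, x (t + 1))) := by
    rw [integral_map (by fun_prop) (by fun_prop)]
  have h2 : ∫ x, w (Preorder.frestrictLe t x) * stepMean π f (x t) ∂(chainLaw μ π) =
      ∫ y, w y * stepMean π f (y ⟨t, Finset.mem_Iic.mpr le_rfl⟩)
        ∂((chainLaw μ π).map (Preorder.frestrictLe t)) := by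
    rw [integral_map (by fun_prop) (by fun_prop)]
    rfl
  simp only [Function.comp_apply]
  rw [h1, h2]
  unfold chainLaw
  rw [← key, Measure.integral_compProd Integrable.of_finite]
  refine integral_congr_ae (ae_of_all _ fun y => ?_)
  simp only [integral_const_mul]
  rw [integral_historyKernel]

/-! ### Martingale convergence and the strong law. -/

/-- The sum of the weighted martingale differences `a t * (f (x (t + 1)) - E[f (x (t + 1)) | x t])`
over the times `t < T`. -/
def martingaleSum (π : Profile n) (f : Fin n → ℝ) (a : ℕ → ℝ) (T : ℕ) (x : ℕ → Fin n) : ℝ :=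
  ∑ t ∈ Finset.range T, a t * (f (x (t + 1)) - stepMean π f (x t))

lemma measurable_coordinate_history {s t : ℕ} (hst : s ≤ t) :
    Measurable[history n t] fun x : ℕ → Fin n => x s := by
  rw [history, Filtration.piLE_eq_comap_frestrictLe]
  exact (measurable_pi_apply (⟨s, Finset.mem_Iic.mpr hst⟩ : Finset.Iic t)).comp
    (comap_measurable (Preorder.frestrictLe (π := fun _ => Fin n) t))

lemma measurable_comp_coordinate_history {s t : ℕ} (hst : s ≤ t) (f : Fin n → ℝ) :
    Measurable[history n t] fun x : ℕ → Fin n => f (x s) :=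
  (measurable_of_finite f).comp (measurable_coordinate_history hst)

lemma measurable_martingaleSum (π : Profile n) (f : Fin n → ℝ) (a : ℕ → ℝ) (T : ℕ) :
    Measurable[history n T] (martingaleSum π f a T) := by
  unfold martingaleSum
  refine Finset.measurable_fun_sum _ fun t ht => ?_
  have ht' := Finset.mem_range.mp ht
  exact ((measurable_comp_coordinate_history (by omega) f).sub
    (measurable_comp_coordinate_history (by omega) _)).const_mul _

lemma exists_abs_le (f : Fin n → ℝ) : ∃ C, 0 ≤ C ∧ ∀ i, |f i| ≤ C :=
  ⟨∑ i, |f i|, Finset.sum_nonneg fun _ _ => abs_nonneg _,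
    fun i => Finset.single_le_sum (f := fun i => |f i|) (fun _ _ => abs_nonneg _) (Finset.mem_univ i)⟩

lemma exists_abs_increment_le (π : Profile n) (f : Fin n → ℝ) :
    ∃ C, 0 ≤ C ∧ ∀ i j, |f j - stepMean π f i| ≤ C := by
  obtain ⟨C, hC, h⟩ := exists_abs_le f
  obtain ⟨D, hD, h'⟩ := exists_abs_le (stepMean π f)
  exact ⟨C + D, by positivity, fun i j => (abs_sub _ _).trans (add_le_add (h j) (h' i))⟩

lemma exists_abs_martingaleSum_le (π : Profile n) (f : Fin n → ℝ) (a : ℕ → ℝ) (T : ℕ) :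
    ∃ C, ∀ x, |martingaleSum π f a T x| ≤ C := by
  obtain ⟨C, hC, h⟩ := exists_abs_increment_le π f
  refine ⟨∑ t ∈ Finset.range T, |a t| * C, fun x => (Finset.abs_sum_le_sum_abs _ _).trans ?_⟩
  refine Finset.sum_le_sum fun t _ => ?_
  rw [abs_mul]
  exact mul_le_mul_of_nonneg_left (h _ _) (abs_nonneg _)

lemma integrable_of_bounded_history (μ : stdSimplex ℝ (Fin n)) (π : Profile n) {t : ℕ}
    {z : (ℕ → Fin n) → ℝ} (hz : Measurable[history n t] z) (hb : ∃ C, ∀ x, |z x| ≤ C) :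
    Integrable z (chainLaw μ π) := by
  obtain ⟨C, hC⟩ := hb
  exact Integrable.of_bound (hz.mono ((history n).le t) le_rfl).aestronglyMeasurable C
    (ae_of_all _ hC)

lemma integral_mul_increment (μ : stdSimplex ℝ (Fin n)) (π : Profile n) (t : ℕ)
    {z : (ℕ → Fin n) → ℝ} (hz : Measurable[history n t] z) (hb : ∃ C, ∀ x, |z x| ≤ C)
    (f : Fin n → ℝ) :
    ∫ x, z x * (f (x (t + 1)) - stepMean π f (x t)) ∂(chainLaw μ π) = 0 := by
  obtain ⟨C, hC⟩ := hb
  have hint : ∀ (g : Fin n → ℝ) (s : ℕ), s ≤ t + 1 →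
      Integrable (fun x => z x * g (x s)) (chainLaw μ π) := by
    intro g s hs
    obtain ⟨D, hD0, hD⟩ := exists_abs_le g
    refine integrable_of_bounded_history μ π (t := t + 1)
      ((hz.mono ((history n).mono (Nat.le_succ t)) le_rfl).mul
        (measurable_comp_coordinate_history hs g)) ⟨C * D, fun x => ?_⟩
    rw [abs_mul]
    exact mul_le_mul (hC x) (hD _) (abs_nonneg _) ((abs_nonneg _).trans (hC x))
  simp only [mul_sub]
  rw [integral_sub (hint f _ le_rfl) (hint _ _ (Nat.le_succ t)), integral_history_mul μ π t z hz f,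
    sub_self]

lemma submartingale_martingaleSum (μ : stdSimplex ℝ (Fin n)) (π : Profile n) (f : Fin n → ℝ)
    (a : ℕ → ℝ) : Submartingale (martingaleSum π f a) (history n) (chainLaw μ π) := by
  have hint : ∀ T, Integrable (martingaleSum π f a T) (chainLaw μ π) := fun T =>
    integrable_of_bounded_history μ π (measurable_martingaleSum π f a T)
      (exists_abs_martingaleSum_le π f a T)
  refine submartingale_of_setIntegral_le_succ
    (fun T => (measurable_martingaleSum π f a T).stronglyMeasurable) hint fun T s hs => le_of_eq ?_
  have hs' : MeasurableSet s := (history n).le T s hs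
  have hsucc : martingaleSum π f a (T + 1) = fun x => martingaleSum π f a T x +
      a T * (f (x (T + 1)) - stepMean π f (x T)) := by
    funext x; exact Finset.sum_range_succ _ _
  have hinc : Integrable (fun x : ℕ → Fin n => a T * (f (x (T + 1)) - stepMean π f (x T)))
      (chainLaw μ π) := by
    have h := (hint (T + 1)).sub (hint T)
    rw [hsucc] at h
    refine h.congr (ae_of_all _ fun x => ?_)
    simp
  rw [hsucc, integral_add (hint T).integrableOn hinc.integrableOn, left_eq_add,
    ← integral_indicator hs']
  have h := integral_mul_increment μ π T (z := s.indicator fun _ => a T)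
    (Measurable.indicator measurable_const hs)
    ⟨|a T|, fun x => by by_cases hx : x ∈ s <;> simp [hx]⟩ f
  rw [← h]
  refine integral_congr_ae (ae_of_all _ fun x => ?_)
  by_cases hx : x ∈ s <;> simp [hx]

/-- Martingale increments are orthogonal, so only their squares contribute; these are bounded
uniformly, and the constant does not depend on the weights `a`. -/
lemma exists_integral_sq_martingaleSum_le (μ : stdSimplex ℝ (Fin n)) (π : Profile n)
    (f : Fin n → ℝ) : ∃ C, 0 ≤ C ∧ ∀ (a : ℕ → ℝ) (T : ℕ),
      ∫ x, martingaleSum π f a T x ^ 2 ∂(chainLaw μ π) ≤ C * ∑ t ∈ Finset.range T, a t ^ 2 := by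
  obtain ⟨C, hC, h⟩ := exists_abs_increment_le π f
  refine ⟨C ^ 2, by positivity, fun a T => ?_⟩
  induction T with
  | zero => simp [martingaleSum]
  | succ T ih =>
    have hm := measurable_martingaleSum π f a T
    obtain ⟨D, hD⟩ := exists_abs_martingaleSum_le π f a T
    have hinc : Measurable[history n (T + 1)]
        fun x : ℕ → Fin n => f (x (T + 1)) - stepMean π f (x T) :=
      (measurable_comp_coordinate_history le_rfl f).sub
        (measurable_comp_coordinate_history (Nat.le_succ T) _)
    have i1 : Integrable (fun x => martingaleSum π f a T x ^ 2) (chainLaw μ π) :=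
      integrable_of_bounded_history μ π (hm.pow_const 2)
        ⟨D ^ 2, fun x => by rw [abs_pow]; exact pow_le_pow_left₀ (abs_nonneg _) (hD x) 2⟩
    have hz : Measurable[history n T] fun x => 2 * a T * martingaleSum π f a T x :=
      hm.const_mul _
    have hzb : ∀ x, |2 * a T * martingaleSum π f a T x| ≤ |2 * a T| * D := fun x => by
      rw [abs_mul]; exact mul_le_mul_of_nonneg_left (hD x) (abs_nonneg _)
    have i2 : Integrable (fun x => (2 * a T * martingaleSum π f a T x) *
        (f (x (T + 1)) - stepMean π f (x T))) (chainLaw μ π) :=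
      integrable_of_bounded_history μ π
        ((hz.mono ((history n).mono (Nat.le_succ T)) le_rfl).mul hinc)
        ⟨|2 * a T| * D * C, fun x => by
          rw [abs_mul]
          exact mul_le_mul (hzb x) (h _ _) (abs_nonneg _) ((abs_nonneg _).trans (hzb x))⟩
    have i12 : Integrable (fun x => martingaleSum π f a T x ^ 2 +
        (2 * a T * martingaleSum π f a T x) * (f (x (T + 1)) - stepMean π f (x T)))
        (chainLaw μ π) := i1.add i2
    have h3 : ∀ x : ℕ → Fin n, (a T * (f (x (T + 1)) - stepMean π f (x T))) ^ 2 ≤ a T ^ 2 * C ^ 2 :=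
      fun x => by
        rw [mul_pow]
        refine mul_le_mul_of_nonneg_left ?_ (sq_nonneg _)
        rw [← sq_abs]
        exact pow_le_pow_left₀ (abs_nonneg _) (h _ _) 2
    have hle : ∫ x, martingaleSum π f a (T + 1) x ^ 2 ∂(chainLaw μ π) ≤
        ∫ x, (martingaleSum π f a T x ^ 2 + (2 * a T * martingaleSum π f a T x) *
          (f (x (T + 1)) - stepMean π f (x T)) + a T ^ 2 * C ^ 2) ∂(chainLaw μ π) := by
      refine integral_mono_of_nonneg (ae_of_all _ fun x => sq_nonneg _)
        (i12.add (integrable_const _)) (ae_of_all _ fun x => ?_)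
      have hs : martingaleSum π f a (T + 1) x = martingaleSum π f a T x +
        a T * (f (x (T + 1)) - stepMean π f (x T)) := Finset.sum_range_succ _ _
      simp only [hs]
      nlinarith [h3 x]
    refine hle.trans ?_
    rw [integral_add i12 (integrable_const _), integral_add i1 i2,
      integral_mul_increment μ π T hz ⟨_, hzb⟩ f, Finset.sum_range_succ]
    simp only [integral_const, probReal_univ, smul_eq_mul, one_mul]
    linarith

lemma ae_exists_tendsto_martingaleSum (μ : stdSimplex ℝ (Fin n)) (π : Profile n)
    (f : Fin n → ℝ) (a : ℕ → ℝ)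
    (hb : ∃ C, ∀ T, ∫ x, |martingaleSum π f a T x| ∂(chainLaw μ π) ≤ C) :
    ∀ᵐ x ∂(chainLaw μ π), ∃ c, Tendsto (fun T => martingaleSum π f a T x) atTop (𝓝 c) := by
  obtain ⟨C, hC⟩ := hb
  refine (submartingale_martingaleSum μ π f a).exists_ae_tendsto_of_bdd (R := C.toNNReal)
    fun T => ?_
  rw [eLpNorm_one_eq_lintegral_enorm,
    ← ofReal_integral_norm_eq_lintegral_enorm ((submartingale_martingaleSum μ π f a).integrable T)]
  exact ENNReal.ofReal_le_ofReal (hC T)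

/-- An instance of Kronecker's lemma. -/
lemma tendsto_average_of_tendsto_sum_div {y : ℕ → ℝ} {c : ℝ}
    (h : Tendsto (fun T => ∑ t ∈ Finset.range T, 1 / ((t : ℝ) + 1) * y t) atTop (𝓝 c)) :
    Tendsto (fun T : ℕ => (T : ℝ)⁻¹ * ∑ t ∈ Finset.range T, y t) atTop (𝓝 0) := by
  set N : ℕ → ℝ := fun T => ∑ t ∈ Finset.range T, 1 / ((t : ℝ) + 1) * y t with hN
  -- Abel summation, from `y t = (t + 1) * (N (t + 1) - N t)`; the average is thus `N T` minus a
  -- Cesàro mean of `N`.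
  have habel : ∀ T : ℕ, ∑ t ∈ Finset.range T, y t = T * N T - ∑ t ∈ Finset.range T, N t := by
    intro T
    induction T with
    | zero => simp
    | succ T ih =>
      have h1 : N (T + 1) = N T + 1 / ((T : ℝ) + 1) * y T := Finset.sum_range_succ _ _
      have h2 : ((T : ℝ) + 1) ≠ 0 := by positivity
      rw [Finset.sum_range_succ, ih, Finset.sum_range_succ, h1]
      push_cast
      field_simp
      ring
  have hlim := h.sub h.cesaro
  rw [sub_self] at hlim
  refine hlim.congr' ?_
  filter_upwards [eventually_gt_atTop 0] with T hT
  have hT' : (T : ℝ) ≠ 0 := by exact_mod_cast hT.ne'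
  rw [habel]
  field_simp

/-- With weights `1 / (t + 1)`, which are square summable, the martingale is bounded in L², hence in
L¹ by `|M| ≤ M ^ 2 + 1`, and converges; Kronecker's lemma then gives the averages. -/
lemma ae_tendsto_average_increment (μ : stdSimplex ℝ (Fin n)) (π : Profile n) (f : Fin n → ℝ) :
    ∀ᵐ x ∂(chainLaw μ π), Tendsto (fun T : ℕ => (T : ℝ)⁻¹ *
      ∑ t ∈ Finset.range T, (f (x (t + 1)) - stepMean π f (x t))) atTop (𝓝 0) := by
  obtain ⟨C, hC, hle⟩ := exists_integral_sq_martingaleSum_le μ π f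
  have hsum : Summable fun t : ℕ => (1 / ((t : ℝ) + 1)) ^ 2 := by
    have := (summable_nat_add_iff 1).mpr (Real.summable_one_div_nat_pow.mpr one_lt_two)
    simpa [div_pow] using this
  have hconv := ae_exists_tendsto_martingaleSum μ π f (fun t => 1 / ((t : ℝ) + 1))
    ⟨C * ∑' t : ℕ, (1 / ((t : ℝ) + 1)) ^ 2 + 1, fun T => ?_⟩
  · filter_upwards [hconv] with x ⟨c, hc⟩
    exact tendsto_average_of_tendsto_sum_div hc
  · set a : ℕ → ℝ := fun t => 1 / ((t : ℝ) + 1)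
    obtain ⟨D, hD⟩ := exists_abs_martingaleSum_le π f a T
    have i1 : Integrable (fun x => martingaleSum π f a T x ^ 2) (chainLaw μ π) :=
      integrable_of_bounded_history μ π ((measurable_martingaleSum π f a T).pow_const 2)
        ⟨D ^ 2, fun x => by rw [abs_pow]; exact pow_le_pow_left₀ (abs_nonneg _) (hD x) 2⟩
    calc ∫ x, |martingaleSum π f a T x| ∂(chainLaw μ π)
        ≤ ∫ x, (martingaleSum π f a T x ^ 2 + 1) ∂(chainLaw μ π) := by
          refine integral_mono_of_nonneg (ae_of_all _ fun x => abs_nonneg _)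
            (i1.add (integrable_const _)) (ae_of_all _ fun x => ?_)
          simp only
          rw [← sq_abs]
          nlinarith [sq_nonneg (|martingaleSum π f a T x| - 1), abs_nonneg (martingaleSum π f a T x)]
      _ = ∫ x, martingaleSum π f a T x ^ 2 ∂(chainLaw μ π) + 1 := by
          rw [integral_add i1 (integrable_const _)]; simp
      _ ≤ _ := by
          gcongr
          exact (hle a T).trans (mul_le_mul_of_nonneg_left
            (hsum.sum_le_tsum _ fun t _ => sq_nonneg _) hC)

/-- For harmonic `h` the unweighted sum telescopes to `h (x T) - h (x 0)`, a bounded martingale. -/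
lemma ae_exists_tendsto_harmonic (μ : stdSimplex ℝ (Fin n)) (π : Profile n) {h : Fin n → ℝ}
    (hh : stepMean π h = h) :
    ∀ᵐ x ∂(chainLaw μ π), ∃ c, Tendsto (fun T : ℕ => h (x T)) atTop (𝓝 c) := by
  have hsum : ∀ T x, martingaleSum π h (fun _ => 1) T x = h (x T) - h (x 0) := by
    intro T x
    simp only [martingaleSum, hh, one_mul]
    exact Finset.sum_range_sub (fun t => h (x t)) T
  obtain ⟨D, hD0, hD⟩ := exists_abs_le h
  have hconv := ae_exists_tendsto_martingaleSum μ π h (fun _ => 1) ⟨D + D, fun T => ?_⟩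
  · filter_upwards [hconv] with x ⟨c, hc⟩
    refine ⟨c + h (x 0), (hc.add_const (h (x 0))).congr fun T => ?_⟩
    rw [hsum, sub_add_cancel]
  · calc ∫ x, |martingaleSum π h (fun _ => 1) T x| ∂(chainLaw μ π)
        ≤ ∫ x, (D + D) ∂(chainLaw μ π) := by
          refine integral_mono_of_nonneg (ae_of_all _ fun x => abs_nonneg _)
            (integrable_const _) (ae_of_all _ fun x => ?_)
          simp only [hsum]
          exact (abs_sub _ _).trans (add_le_add (hD _) (hD _))
      _ = D + D := by simp

/-! ### Payoffs and the Poisson equation. -/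

lemma integral_coordinate_succ (μ : stdSimplex ℝ (Fin n)) (π : Profile n) (f : Fin n → ℝ) (t : ℕ) :
    ∫ x, f (x (t + 1)) ∂(chainLaw μ π) = ∫ x, stepMean π f (x t) ∂(chainLaw μ π) := by
  simpa using integral_history_mul μ π t (fun _ => 1) measurable_const f

lemma integral_coordinate (μ : stdSimplex ℝ (Fin n)) (π : Profile n) (f : Fin n → ℝ) (t : ℕ) :
    ∫ x, f (x t) ∂(chainLaw μ π) = ∑ j, μ j * (stepMean π ^ t) f j := by
  induction t generalizing f with
  | zero => simpa using integral_coordinate_zero μ π f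
  | succ t ih => rw [integral_coordinate_succ, ih, pow_succ]; rfl

/-- The payoff of player `i` in terms of a solution of the Poisson equation. -/
theorem payoff_eq_of_poisson (μ : stdSimplex ℝ (Fin n)) (π : Profile n) (i : Fin n)
    {h g : Fin n → ℝ} (hh : stepMean π h = h) (hg : Pi.single i 1 - h = g - stepMean π g) :
    payoff μ i π = ∑ j, μ j * h j := by
  have hfreq : ∀ᵐ x ∂(chainLaw μ π),
      Tendsto (fun T : ℕ => h (x T)) atTop (𝓝 (limUnder atTop (frequency i x))) := by
    filter_upwards [ae_tendsto_average_increment μ π g, ae_exists_tendsto_harmonic μ π hh]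
      with x hx ⟨c, hc⟩
    have hlim : Tendsto (frequency i x) atTop (𝓝 c) := by
      obtain ⟨D, hD0, hD⟩ := exists_abs_le (stepMean π g)
      have h1 : Tendsto (fun T : ℕ => (T : ℝ)⁻¹ * (stepMean π g (x 0) - stepMean π g (x T)))
          atTop (𝓝 0) := by
        refine squeeze_zero_norm (a := fun T : ℕ => (T : ℝ)⁻¹ * (D + D)) (fun T => ?_) ?_
        · rw [norm_mul, Real.norm_of_nonneg (by positivity : (0 : ℝ) ≤ (T : ℝ)⁻¹)]
          exact mul_le_mul_of_nonneg_left ((abs_sub _ _).trans (add_le_add (hD _) (hD _)))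
            (by positivity)
        · simpa using tendsto_inv_atTop_nhds_zero_nat.mul_const (D + D)
      -- The frequency splits into the Cesàro mean of `h (x (t + 1))`, the average martingale
      -- increment of `g`, and a telescoping boundary term divided by `T`.
      have h2 := ((hc.comp (tendsto_add_atTop_nat 1)).cesaro.add hx).add h1
      rw [add_zero, add_zero] at h2
      refine h2.congr fun T => ?_
      have hshift : ∑ t ∈ Finset.Icc 1 T, (if x t = i then (1 : ℝ) else 0) =
          ∑ t ∈ Finset.range T, (if x (t + 1) = i then (1 : ℝ) else 0) := by
        rw [Finset.range_eq_Ico, Finset.sum_Ico_add' (fun t => if x t = i then (1 : ℝ) else 0) 0 T 1]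
        rfl
      have hpt : ∀ j, (if j = i then (1 : ℝ) else 0) = h j + (g j - stepMean π g j) := by
        intro j
        have := congrFun hg j
        simp only [Pi.sub_apply, Pi.single_apply] at this
        linarith
      have htel := Finset.sum_range_sub (fun t => stepMean π g (x t)) T
      rw [frequency, hshift, one_div, ← mul_add, ← mul_add]
      congr 1
      rw [← neg_sub (stepMean π g (x T)), ← htel, ← Finset.sum_neg_distrib,
        ← Finset.sum_add_distrib, ← Finset.sum_add_distrib]
      refine Finset.sum_congr rfl fun t _ => ?_
      rw [hpt]
      simp only [Function.comp_apply]
      ring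
    rwa [hlim.limUnder_eq]
  obtain ⟨D, hD0, hD⟩ := exists_abs_le h
  have hdom := tendsto_integral_of_dominated_convergence (μ := chainLaw μ π)
    (F := fun (T : ℕ) x => h (x T)) (fun _ => D)
    (fun T => ((measurable_of_finite h).comp (measurable_pi_apply T)).aestronglyMeasurable)
    (integrable_const _) (fun T => ae_of_all _ fun x => hD (x T)) hfreq
  have hpow : ∀ t : ℕ, (stepMean π ^ t) h = h := by
    intro t
    induction t with
    | zero => rfl
    | succ t ih => rw [pow_succ, Module.End.mul_apply, hh, ih]
  simp only [integral_coordinate, hpow] at hdom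
  exact tendsto_nhds_unique hdom tendsto_const_nhds

/-! ### Closed sets, the minimum principle and hitting probabilities. -/

lemma stepMean_mono (π : Profile n) {f g : Fin n → ℝ} (h : f ≤ g) :
    stepMean π f ≤ stepMean π g := fun i => by
  rw [stepMean_apply, stepMean_apply]
  exact Finset.sum_le_sum fun j _ => mul_le_mul_of_nonneg_left (h j) (prob_nonneg (π i) j)

lemma stepMean_const (π : Profile n) (c : ℝ) : stepMean π (fun _ => c) = fun _ => c := by
  funext i
  rw [stepMean_apply, ← Finset.sum_mul, sum_prob, one_mul]

lemma stepMean_pow_mem_Icc (π : Profile n) {f : Fin n → ℝ} {a b : ℝ}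
    (h : ∀ j, f j ∈ Set.Icc a b) (t : ℕ) (j : Fin n) : (stepMean π ^ t) f j ∈ Set.Icc a b := by
  induction t generalizing j with
  | zero => exact h j
  | succ t ih =>
    rw [pow_succ', Module.End.mul_apply]
    have h1 := stepMean_mono π (f := fun _ => a) (fun k => (ih k).1) j
    have h2 := stepMean_mono π (g := fun _ => b) (fun k => (ih k).2) j
    rw [stepMean_const] at h1 h2
    exact ⟨h1, h2⟩

/-- A set of vertices which no edge of positive probability leaves. -/
def IsClosedUnder (π : Profile n) (S : Set (Fin n)) : Prop :=
  ∀ k ∈ S, ∀ l, 0 < π k l → l ∈ S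

lemma IsClosedUnder.mem_of_reaches {π : Profile n} {S : Set (Fin n)} (hS : IsClosedUnder π S)
    {j k : Fin n} (hj : j ∈ S) (h : Reaches π j k) : k ∈ S := by
  induction h with
  | refl => exact hj
  | tail _ hbc ih => exact hS _ ih _ hbc

lemma isClosedUnder_reaches (π : Profile n) (j : Fin n) : IsClosedUnder π {k | Reaches π j k} :=
  fun _ hk _ hl => Relation.ReflTransGen.tail hk hl

lemma prob_eq_zero_of_notMem {π : Profile n} {S : Set (Fin n)} (hS : IsClosedUnder π S)
    {k l : Fin n} (hk : k ∈ S) (hl : l ∉ S) : π k l = 0 :=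
  le_antisymm (not_lt.mp fun h => hl (hS k hk l h)) (prob_nonneg _ _)

lemma stepMean_congr_of_closed {π : Profile n} {S : Set (Fin n)} (hS : IsClosedUnder π S)
    {f g : Fin n → ℝ} (h : ∀ k ∈ S, f k = g k) {k : Fin n} (hk : k ∈ S) :
    stepMean π f k = stepMean π g k := by
  rw [stepMean_apply, stepMean_apply]
  refine Finset.sum_congr rfl fun l _ => ?_
  by_cases hl : l ∈ S
  · rw [h l hl]
  · rw [prob_eq_zero_of_notMem hS hk hl, zero_mul, zero_mul]

lemma stepMean_pow_eq_const_of_closed {π : Profile n} {S : Set (Fin n)} (hS : IsClosedUnder π S)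
    {f : Fin n → ℝ} {c : ℝ} (h : ∀ k ∈ S, f k = c) (t : ℕ) {k : Fin n} (hk : k ∈ S) :
    (stepMean π ^ t) f k = c := by
  induction t generalizing k with
  | zero => exact h k hk
  | succ t ih =>
    rw [pow_succ', Module.End.mul_apply,
      stepMean_congr_of_closed hS (g := fun _ => c) (fun l hl => ih hl) hk, stepMean_const]

/-- The minimum principle. -/
lemma eq_of_reaches_of_isMin {π : Profile n} {u : Fin n → ℝ} (hu : stepMean π u = u)
    {S : Set (Fin n)} (hS : IsClosedUnder π S) {m : ℝ} (hm : ∀ k ∈ S, m ≤ u k) {j k : Fin n}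
    (hj : j ∈ S) (huj : u j = m) (h : Reaches π j k) : u k = m := by
  induction h with
  | refl => exact huj
  | @tail b c hjb hbc ih =>
    have hb : b ∈ S := hS.mem_of_reaches hj hjb
    -- At `b` the minimum equals the average of `u`, so every term of this nonnegative sum vanishes.
    have hsum : ∑ l, π b l * (u l - m) = 0 := by
      have := congrFun hu b
      rw [stepMean_apply] at this
      simp only [mul_sub, Finset.sum_sub_distrib, ← Finset.sum_mul, sum_prob]
      linarith
    have hnonneg : ∀ l ∈ Finset.univ, 0 ≤ π b l * (u l - m) := fun l _ => by
      by_cases hl : l ∈ S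
      · exact mul_nonneg (prob_nonneg _ _) (sub_nonneg.mpr (hm l hl))
      · rw [prob_eq_zero_of_notMem hS hb hl, zero_mul]
    have := (Finset.sum_eq_zero_iff_of_nonneg hnonneg).mp hsum c (Finset.mem_univ c)
    rcases mul_eq_zero.mp this with h0 | h0
    · exact absurd h0 hbc.ne'
    · exact sub_eq_zero.mp h0

/-- The properties of the probability `u` of reaching the closed set `R`. -/
structure IsHittingProb (π : Profile n) (R : Set (Fin n)) (u : Fin n → ℝ) : Prop where
  harmonic : stepMean π u = u
  mem_Icc : ∀ j, u j ∈ Set.Icc (0 : ℝ) 1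
  eq_one : ∀ j ∈ R, u j = 1
  eq_zero : ∀ j, (∀ r ∈ R, ¬ Reaches π j r) → u j = 0

lemma IsHittingProb.eq_one_of_reaches {π : Profile n} {R : Set (Fin n)} {u : Fin n → ℝ}
    (hu : IsHittingProb π R u) {j k : Fin n} (hj : u j = 1) (h : Reaches π j k) : u k = 1 := by
  have h1 : stepMean π (-u) = -u := by rw [map_neg, hu.harmonic]
  have h2 := eq_of_reaches_of_isMin h1 (S := Set.univ) (fun _ _ _ _ => Set.mem_univ _) (m := -1)
    (fun k _ => neg_le_neg (hu.mem_Icc k).2) (Set.mem_univ j) (by simp [hj]) h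
  simpa using h2

/-- The value 1 propagates along paths, and `u` is 0 where `R` is out of reach. Conversely, a
minimizer of `u` among the vertices reachable from `j` leads to `R`, so the minimum is already 1. -/
lemma IsHittingProb.eq_one_iff {π : Profile n} {R : Set (Fin n)} {u : Fin n → ℝ}
    (hu : IsHittingProb π R u) (j : Fin n) :
    u j = 1 ↔ ∀ k, Reaches π j k → ∃ r ∈ R, Reaches π k r := by
  constructor
  · intro hj k hk
    by_contra! hcon
    have h1 := hu.eq_one_of_reaches hj hk
    rw [hu.eq_zero k hcon] at h1
    exact zero_ne_one h1
  · intro h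
    obtain ⟨k, hk, hmin⟩ := Set.exists_min_image {k | Reaches π j k} u (Set.toFinite _)
      ⟨j, Relation.ReflTransGen.refl⟩
    obtain ⟨r, hr, hkr⟩ := h k hk
    have h1 := eq_of_reaches_of_isMin hu.harmonic (isClosedUnder_reaches π j) hmin hk rfl hkr
    rw [hu.eq_one r hr] at h1
    exact le_antisymm (hu.mem_Icc j).2 (h1.trans_le (hmin j Relation.ReflTransGen.refl))

lemma isClosedUnder_not_reaches (π : Profile n) (R : Set (Fin n)) :
    IsClosedUnder π {j | ∀ r ∈ R, ¬ Reaches π j r} :=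
  fun _ hk _ hl r hr h => hk r hr (Relation.ReflTransGen.head hl h)

lemma stepMean_pow_indicator_mem_Icc (π : Profile n) (R : Set (Fin n)) (t : ℕ) (j : Fin n) :
    (stepMean π ^ t) (R.indicator 1) j ∈ Set.Icc (0 : ℝ) 1 := by
  refine stepMean_pow_mem_Icc π (fun j => ?_) t j
  by_cases hj : j ∈ R <;> simp [hj]

/-- A harmonic function whose values are limits of values of iterates of the indicator of `R`. -/
lemma isHittingProb_of_approx {π : Profile n} {R : Set (Fin n)} (hR : IsClosedUnder π R)
    {u : Fin n → ℝ} (hu : stepMean π u = u)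
    (happ : ∀ (j : Fin n) (a b : ℝ),
      (∀ t, (stepMean π ^ t) (R.indicator 1) j ∈ Set.Icc a b) → u j ∈ Set.Icc a b) :
    IsHittingProb π R u where
  harmonic := hu
  mem_Icc j := happ j 0 1 fun t => stepMean_pow_indicator_mem_Icc π R t j
  eq_one j hj := by
    have := happ j 1 1 fun t => by
      rw [stepMean_pow_eq_const_of_closed hR (c := 1) (fun k hk => by simp [hk]) t hj]; simp
    simpa using this
  eq_zero j hj := by
    have := happ j 0 0 fun t => by
      rw [stepMean_pow_eq_const_of_closed (isClosedUnder_not_reaches π R) (c := 0)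
        (fun k hk => ?_) t hj]
      · simp
      · exact Set.indicator_of_notMem (fun hkR => hk k hkR Relation.ReflTransGen.refl) _
    simpa using this

lemma stepMean_pow_abs_le (π : Profile n) (f : Fin n → ℝ) :
    ∃ C, ∀ t j, |(stepMean π ^ t) f j| ≤ C := by
  obtain ⟨C, -, hC⟩ := exists_abs_le f
  exact ⟨C, fun t j => abs_le.mpr
    (stepMean_pow_mem_Icc π (fun k => abs_le.mp (hC k)) t j)⟩

/-! ### Ergodic decomposition. -/

/-- The ergodic decomposition of a function into a harmonic part and a coboundary. -/
lemma exists_poisson_solution (π : Profile n) (f : Fin n → ℝ) :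
    ∃ h g : Fin n → ℝ, stepMean π h = h ∧ f - h = g - stepMean π g := by
  have hdisj : Disjoint (LinearMap.ker (1 - stepMean π)) (LinearMap.range (1 - stepMean π)) := by
    rw [Submodule.disjoint_def]
    rintro v hv ⟨g, hg⟩
    have hv' : stepMean π v = v := by
      rw [LinearMap.mem_ker, LinearMap.sub_apply, Module.End.one_apply, sub_eq_zero] at hv
      exact hv.symm
    have hg' : stepMean π g = g - v := by
      rw [← hg, LinearMap.sub_apply, Module.End.one_apply, sub_sub_cancel]
    -- A harmonic coboundary `v = g - πg` makes the iterates of `g` grow linearly; they are bounded,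
    -- so `v = 0`.
    have hpow : ∀ t : ℕ, (stepMean π ^ t) g = g - (t : ℝ) • v := by
      intro t
      induction t with
      | zero => simp
      | succ t ih =>
        rw [pow_succ', Module.End.mul_apply, ih, map_sub, map_smul, hv', hg']
        push_cast
        rw [add_smul, one_smul]
        abel
    obtain ⟨C, hC⟩ := stepMean_pow_abs_le π g
    funext j
    by_contra hj
    obtain ⟨t, ht⟩ := exists_nat_gt ((C + |g j|) / |v j|)
    have hpos : 0 < |v j| := abs_pos.mpr hj
    rw [div_lt_iff₀ hpos] at ht
    have h1 := hC t j
    rw [hpow] at h1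
    simp only [Pi.sub_apply, Pi.smul_apply, smul_eq_mul] at h1
    have h2 := abs_sub_abs_le_abs_sub ((t : ℝ) * v j) (g j)
    rw [abs_mul, Nat.abs_cast, abs_sub_comm] at h2
    linarith
  -- By rank-nullity, a kernel and a range that meet trivially span everything.
  have htop := Submodule.eq_top_of_disjoint _ _ (by
    rw [add_comm]; exact (LinearMap.finrank_range_add_finrank_ker (1 - stepMean π)).ge) hdisj
  obtain ⟨h, hh, v, ⟨g, rfl⟩, hsum⟩ := Submodule.mem_sup.mp (htop ▸ Submodule.mem_top (x := f))
  refine ⟨h, g, ?_, ?_⟩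
  · rw [LinearMap.mem_ker, LinearMap.sub_apply, Module.End.one_apply, sub_eq_zero] at hh
    exact hh.symm
  · rw [← hsum, add_sub_cancel_left]
    rfl

/-- The harmonic part of `f` is a limit of averages of the iterates of `f`. -/
lemma mem_Icc_of_poisson {π : Profile n} {f h g : Fin n → ℝ} (hh : stepMean π h = h)
    (hg : f - h = g - stepMean π g) (j : Fin n) (a b : ℝ)
    (hab : ∀ t, (stepMean π ^ t) f j ∈ Set.Icc a b) : h j ∈ Set.Icc a b := by
  have hpow : ∀ t : ℕ, (stepMean π ^ t) f = h + ((stepMean π ^ t) g - (stepMean π ^ (t + 1)) g) := by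
    intro t
    induction t with
    | zero => simp [← hg]
    | succ t ih =>
      rw [pow_succ', Module.End.mul_apply, ih, map_add, hh, map_sub, ← Module.End.mul_apply,
        ← Module.End.mul_apply, ← pow_succ', ← pow_succ']
  have hsum : ∀ T : ℕ, ∑ t ∈ Finset.range T, (stepMean π ^ t) f j =
      T * h j + (g j - (stepMean π ^ T) g j) := by
    intro T
    have := Finset.sum_range_sub' (fun t => (stepMean π ^ t) g j) T
    simp only [pow_zero, Module.End.one_apply] at this
    rw [← this]
    simp [hpow, Finset.sum_add_distrib]
  obtain ⟨C, hC⟩ := stepMean_pow_abs_le π g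
  have hlim : Tendsto (fun T : ℕ => (T : ℝ)⁻¹ * ∑ t ∈ Finset.range T, (stepMean π ^ t) f j)
      atTop (𝓝 (h j)) := by
    have h1 : Tendsto (fun T : ℕ => (T : ℝ)⁻¹ * (g j - (stepMean π ^ T) g j)) atTop (𝓝 0) := by
      refine squeeze_zero_norm (a := fun T : ℕ => (T : ℝ)⁻¹ * (|g j| + C)) (fun T => ?_) ?_
      · rw [norm_mul, Real.norm_of_nonneg (by positivity : (0 : ℝ) ≤ (T : ℝ)⁻¹)]
        exact mul_le_mul_of_nonneg_left ((abs_sub _ _).trans (add_le_add_right (hC _ _) _))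
          (by positivity)
      · simpa using tendsto_inv_atTop_nhds_zero_nat.mul_const (|g j| + C)
    have h2 := h1.const_add (h j)
    rw [add_zero] at h2
    refine h2.congr' ?_
    filter_upwards [eventually_gt_atTop 0] with T hT
    have hT' : (T : ℝ) ≠ 0 := by exact_mod_cast hT.ne'
    rw [hsum]
    field_simp
  refine isClosed_Icc.mem_of_tendsto hlim ?_
  filter_upwards [eventually_gt_atTop 0] with T hT
  have hT' : (0 : ℝ) < T := by exact_mod_cast hT
  have h1 := Finset.sum_le_sum fun t (_ : t ∈ Finset.range T) => (hab t).1
  have h2 := Finset.sum_le_sum fun t (_ : t ∈ Finset.range T) => (hab t).2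
  rw [Finset.sum_const, Finset.card_range, nsmul_eq_mul] at h1 h2
  constructor
  · rwa [le_inv_mul_iff₀ hT']
  · rwa [inv_mul_le_iff₀ hT']

lemma exists_hittingProb {π : Profile n} {R : Set (Fin n)} (hR : IsClosedUnder π R) :
    ∃ u g : Fin n → ℝ, IsHittingProb π R u ∧ R.indicator 1 - u = g - stepMean π g := by
  obtain ⟨u, g, hu, hg⟩ := exists_poisson_solution π (R.indicator 1)
  exact ⟨u, g, isHittingProb_of_approx hR hu (mem_Icc_of_poisson hu hg), hg⟩

/-! ### Absorption probabilities. -/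

lemma ae_closed (μ : stdSimplex ℝ (Fin n)) {π : Profile n} {R : Set (Fin n)}
    (hR : IsClosedUnder π R) :
    ∀ᵐ x ∂(chainLaw μ π), ∀ t, x t ∈ R → x (t + 1) ∈ R := by
  rw [ae_all_iff]
  intro t
  have hz : Measurable[history n t] fun x : ℕ → Fin n => R.indicator (1 : Fin n → ℝ) (x t) :=
    measurable_comp_coordinate_history le_rfl _
  have h0 := integral_history_mul μ π t _ hz (Rᶜ.indicator 1)
  have h1 : ∀ x : ℕ → Fin n,
      R.indicator (1 : Fin n → ℝ) (x t) * stepMean π (Rᶜ.indicator 1) (x t) = 0 := by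
    intro x
    by_cases hx : x t ∈ R
    · rw [stepMean_congr_of_closed hR (g := fun _ => 0) (fun k hk => by simp [hk]) hx,
        stepMean_const, mul_zero]
    · simp [hx]
  simp only [h1, integral_zero] at h0
  rw [integral_eq_zero_iff_of_nonneg] at h0
  · filter_upwards [h0] with x hx hxt
    by_contra hcon
    simp [hxt, hcon] at hx
  · intro x
    exact mul_nonneg (Set.indicator_nonneg (fun _ _ => zero_le_one) _)
      (Set.indicator_nonneg (fun _ _ => zero_le_one) _)
  · refine integrable_of_bounded_history μ π (t := t + 1)
      ((measurable_comp_coordinate_history (Nat.le_succ t) _).mul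
        (measurable_comp_coordinate_history le_rfl _)) ⟨1, fun x => ?_⟩
    by_cases h1 : x t ∈ R <;> by_cases h2 : x (t + 1) ∈ R <;> simp [h1, h2]

/-- The iterate is the probability of being in `R` at time `T`. Almost surely the chain never leaves
`R`, so these events tend to the event of ever visiting `R`. -/
lemma tendsto_stepMean_pow_absorptionProb {π : Profile n} {R : Finset (Fin n)}
    (hR : IsClosedUnder π (R : Set (Fin n))) (j : Fin n) :
    Tendsto (fun T => (stepMean π ^ T) ((R : Set (Fin n)).indicator 1) j) atTop
      (𝓝 (absorptionProb π j R)) := by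
  have hmeas : MeasurableSet {x : ℕ → Fin n | ∃ T, x T ∈ R} := by
    have : {x : ℕ → Fin n | ∃ T, x T ∈ R} = ⋃ T, (fun x => x T) ⁻¹' (R : Set (Fin n)) := by
      ext x; simp
    rw [this]
    exact MeasurableSet.iUnion fun T => measurable_pi_apply T (R.measurableSet)
  have hdom := tendsto_integral_of_dominated_convergence
    (μ := chainLaw (stdSimplex.vertex j) π)
    (F := fun (T : ℕ) x => (R : Set (Fin n)).indicator (1 : Fin n → ℝ) (x T))
    (f := {x : ℕ → Fin n | ∃ T, x T ∈ R}.indicator 1) (fun _ => 1)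
    (fun T => ((measurable_of_finite ((R : Set (Fin n)).indicator (1 : Fin n → ℝ))).comp
      (measurable_pi_apply T)).aestronglyMeasurable)
    (integrable_const _) (fun T => ae_of_all _ fun x => by
      by_cases h : x T ∈ R <;> simp [h]) ?_
  · rw [integral_indicator_one hmeas] at hdom
    rw [absorptionProb]
    simpa [integral_coordinate, Pi.single_apply] using hdom
  · filter_upwards [ae_closed (stdSimplex.vertex j) hR] with x hx
    by_cases h : ∃ T, x T ∈ R
    · obtain ⟨T, hT⟩ := h
      have hev : ∀ S ≥ T, x S ∈ R := fun S hS => Nat.le_induction hT (fun t _ ih => hx t ih) S hS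
      refine tendsto_const_nhds.congr' ?_
      filter_upwards [eventually_ge_atTop T] with S hS
      have h1 : x ∈ {x : ℕ → Fin n | ∃ T, x T ∈ R} := ⟨T, hT⟩
      rw [Set.indicator_of_mem h1, Set.indicator_of_mem (by exact_mod_cast hev S hS)]
      rfl
    · refine tendsto_const_nhds.congr fun S => ?_
      have h1 : x ∉ {x : ℕ → Fin n | ∃ T, x T ∈ R} := h
      rw [Set.indicator_of_notMem h1, Set.indicator_of_notMem]
      exact fun hS => h ⟨S, by exact_mod_cast hS⟩

/-- Absorption with probability one is a property of the graph of positive probabilities. -/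
theorem absorptionProb_eq_one_iff {π : Profile n} {R : Finset (Fin n)}
    (hR : IsClosedUnder π (R : Set (Fin n))) (j : Fin n) :
    absorptionProb π j R = 1 ↔ ∀ k, Reaches π j k → ∃ r ∈ R, Reaches π k r := by
  have hlim := tendsto_stepMean_pow_absorptionProb hR
  have hu : stepMean π (fun j => absorptionProb π j R) = fun j => absorptionProb π j R := by
    funext i
    have h1 := (hlim i).comp (tendsto_add_atTop_nat 1)
    have h2 : Tendsto (fun T => ∑ k, π i k * (stepMean π ^ T) ((R : Set (Fin n)).indicator 1) k)
        atTop (𝓝 (∑ k, π i k * absorptionProb π k R)) :=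
      tendsto_finsetSum _ fun k _ => (hlim k).const_mul _
    refine tendsto_nhds_unique h2 (h1.congr fun T => ?_)
    rw [Function.comp_apply, pow_succ', Module.End.mul_apply, stepMean_apply]
  have hhit := isHittingProb_of_approx hR hu fun j a b hab =>
    isClosed_Icc.mem_of_tendsto (hlim j) (Eventually.of_forall hab)
  exact_mod_cast hhit.eq_one_iff j

/-! ### Reachability when one row changes. -/

section Deviation

variable {π π' : Profile n} {i : Fin n}

/-- Cut the path at its first visit to `i`: up to there it uses no edge leaving `i`. -/
lemma Reaches.of_agree (h : ∀ k, k ≠ i → π k = π' k) {j : Fin n} (hj : Reaches π j i) :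
    Reaches π' j i := by
  induction hj using Relation.ReflTransGen.head_induction_on with
  | refl => exact Relation.ReflTransGen.refl
  | @head a b hab _ ih =>
    by_cases ha : a = i
    · rw [ha]; exact Relation.ReflTransGen.refl
    · exact Relation.ReflTransGen.head (by rwa [← h a ha]) ih

lemma reaches_iff_of_agree (h : ∀ k, k ≠ i → π k = π' k) (j : Fin n) :
    Reaches π j i ↔ Reaches π' j i :=
  ⟨Reaches.of_agree h, Reaches.of_agree fun k hk => (h k hk).symm⟩

lemma Reaches.of_agree_of_not_reaches (h : ∀ k, k ≠ i → π k = π' k) {j k : Fin n}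
    (hj : ¬ Reaches π j i) (hk : Reaches π j k) : Reaches π' j k := by
  induction hk with
  | refl => exact Relation.ReflTransGen.refl
  | @tail b c hjb hbc ih =>
    have hb : b ≠ i := by rintro rfl; exact hj hjb
    exact ih.tail (by rwa [← h b hb])

lemma reaches_iff_of_agree_of_not_reaches (h : ∀ k, k ≠ i → π k = π' k) {j : Fin n}
    (hj : ¬ Reaches π j i) (k : Fin n) : Reaches π j k ↔ Reaches π' j k :=
  ⟨Reaches.of_agree_of_not_reaches h hj, Reaches.of_agree_of_not_reaches
    (fun k hk => (h k hk).symm) (mt (reaches_iff_of_agree h j).mpr hj)⟩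

end Deviation

/-- The vertex `i` is recurrent: it can be reached from every vertex which it can reach. -/
def IsRecurrent (π : Profile n) (i : Fin n) : Prop :=
  ∀ k, Reaches π i k → Reaches π k i

lemma isClosedUnder_singleton {Q : Profile n} {i : Fin n} (hQ : Q i = stdSimplex.vertex i) :
    IsClosedUnder Q {i} := by
  rintro k rfl l hl
  rw [hQ] at hl
  by_contra hne
  simp [Pi.single_eq_of_ne hne] at hl

/-! ### The payoff through the chain stopped at `i`. -/

section Payoff

variable {π Q : Profile n} {i : Fin n} {u g : Fin n → ℝ}

lemma stepMean_eq_of_agree (hQ : ∀ k, k ≠ i → π k = Q k) (f : Fin n → ℝ) {k : Fin n} (hk : k ≠ i) :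
    stepMean π f k = stepMean Q f k := by
  rw [stepMean_apply, stepMean_apply, hQ k hk]

/-- The mean return time to `i`, in terms of the potential `g` of the chain stopped at `i`. -/
def returnTime (π : Profile n) (i : Fin n) (g : Fin n → ℝ) : ℝ :=
  1 + g i - stepMean π g i

/-- Off `i` the function `u` is harmonic for `π`, and at `i` it exceeds its mean by a positive
amount. So the indicator of `i` is a multiple of `u - πu`, with harmonic part 0. -/
lemma payoff_eq_zero (μ : stdSimplex ℝ (Fin n)) (hQ : ∀ k, k ≠ i → π k = Q k)
    (hu : IsHittingProb Q {i} u) (hlt : stepMean π u i < 1) : payoff μ i π = 0 := by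
  rw [payoff_eq_of_poisson μ π i (h := 0) (g := (1 - stepMean π u i)⁻¹ • u) (map_zero _)]
  · simp
  · have hne : 1 - stepMean π u i ≠ 0 := (sub_pos.mpr hlt).ne'
    rw [map_smul, ← smul_sub]
    funext k
    simp only [Pi.sub_apply, Pi.smul_apply, smul_eq_mul, Pi.zero_apply, sub_zero]
    by_cases hk : k = i
    · subst hk
      rw [Pi.single_eq_same, hu.eq_one k rfl, inv_mul_cancel₀ hne]
    · rw [Pi.single_eq_of_ne hk, stepMean_eq_of_agree hQ u hk, hu.harmonic, sub_self, mul_zero]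

/-- Off `i` this is the equation for `Q`; at `i` it is what `returnTime` is defined to satisfy.
Divided by the return time, it becomes the Poisson equation for `π`. -/
lemma poisson_returnTime (hQ : ∀ k, k ≠ i → π k = Q k) (hu : IsHittingProb Q {i} u)
    (hg : Pi.single i 1 - u = g - stepMean Q g) (k : Fin n) :
    g k - stepMean π g k = returnTime π i g * (Pi.single i 1 : Fin n → ℝ) k - u k := by
  by_cases hk : k = i
  · subst hk
    rw [Pi.single_eq_same, hu.eq_one k rfl, returnTime]
    ring
  · have := congrFun hg k
    simp only [Pi.sub_apply, Pi.single_eq_of_ne hk] at this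
    rw [stepMean_eq_of_agree hQ g hk, ← this, Pi.single_eq_of_ne hk, mul_zero]

lemma harmonic_of_recurrent (hQ : ∀ k, k ≠ i → π k = Q k) (hu : IsHittingProb Q {i} u)
    (hone : stepMean π u i = 1) : stepMean π u = u := by
  funext k
  by_cases hk : k = i
  · subst hk; rw [hone, hu.eq_one k rfl]
  · rw [stepMean_eq_of_agree hQ u hk, hu.harmonic]

lemma payoff_eq_div (μ : stdSimplex ℝ (Fin n)) (hQ : ∀ k, k ≠ i → π k = Q k)
    (hu : IsHittingProb Q {i} u) (hg : Pi.single i 1 - u = g - stepMean Q g)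
    (hone : stepMean π u i = 1) (hm : returnTime π i g ≠ 0) :
    payoff μ i π = (∑ j, μ j * u j) / returnTime π i g := by
  rw [payoff_eq_of_poisson μ π i (h := (returnTime π i g)⁻¹ • u) (g := (returnTime π i g)⁻¹ • g)]
  · rw [Finset.sum_div]
    refine Finset.sum_congr rfl fun j _ => ?_
    simp only [Pi.smul_apply, smul_eq_mul]
    ring
  · rw [map_smul, harmonic_of_recurrent hQ hu hone]
  · rw [map_smul, ← smul_sub]
    funext k
    simp only [Pi.sub_apply, Pi.smul_apply, smul_eq_mul]
    rw [poisson_returnTime hQ hu hg]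
    field_simp

lemma sum_mul_hittingProb_pos {μ : stdSimplex ℝ (Fin n)} (hμ : ∀ i, 0 < μ i)
    (hu : IsHittingProb Q {i} u) : 0 < ∑ j, μ j * u j :=
  Finset.sum_pos' (fun j _ => mul_nonneg (hμ j).le (hu.mem_Icc j).1)
    ⟨i, Finset.mem_univ i, by rw [hu.eq_one i rfl, mul_one]; exact hμ i⟩

lemma stepMean_le_one (hu : IsHittingProb Q {i} u) : stepMean π u i ≤ 1 := by
  have := stepMean_mono π (g := fun _ => 1) (fun k => (hu.mem_Icc k).2) i
  rwa [stepMean_const] at this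

/-- The vertices from which `i` is reached with probability one have hitting probability one. -/
lemma hittingProb_eq_one (hQ : ∀ k, k ≠ i → π k = Q k) (hQi : Q i = stdSimplex.vertex i)
    (hu : IsHittingProb Q {i} u) {j : Fin n} (hj : ∀ k, Reaches π j k → Reaches π k i) :
    u j = 1 := by
  rw [hu.eq_one_iff]
  intro k hk
  refine ⟨i, rfl, (reaches_iff_of_agree hQ k).mp ?_⟩
  -- A `Q`-path is a `π`-path unless it has been absorbed at `i`.
  have hmem : Reaches π j k ∨ k = i := by
    induction hk with
    | refl => exact Or.inl Relation.ReflTransGen.refl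
    | @tail b c _ hbc ih =>
      by_cases hb : b = i
      · subst hb
        exact Or.inr (isClosedUnder_singleton hQi b rfl c hbc)
      · rcases ih with h | h
        · exact Or.inl (Relation.ReflTransGen.tail h (by rwa [hQ b hb]))
        · exact absurd h hb
  rcases hmem with h | rfl
  · exact hj k h
  · exact Relation.ReflTransGen.refl

/-- If the mean is 1, then `u` is harmonic for `π` with its maximum 1 at `i`, hence equals 1
wherever `i` leads, and a nonzero `u` requires a path back to `i`. -/
lemma stepMean_eq_one_iff (hQ : ∀ k, k ≠ i → π k = Q k) (hQi : Q i = stdSimplex.vertex i)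
    (hu : IsHittingProb Q {i} u) : stepMean π u i = 1 ↔ IsRecurrent π i := by
  constructor
  · intro hone k hk
    have h1 : stepMean π (-u) = -u := by rw [map_neg, harmonic_of_recurrent hQ hu hone]
    have h2 := eq_of_reaches_of_isMin h1 (S := Set.univ) (fun _ _ _ _ => Set.mem_univ _) (m := -1)
      (fun k _ => neg_le_neg (hu.mem_Icc k).2) (Set.mem_univ i) (by simp [hu.eq_one i rfl]) hk
    have h3 : u k = 1 := by simpa using h2
    by_contra hcon
    rw [hu.eq_zero k fun r hr h => hcon ((reaches_iff_of_agree hQ k).mpr (hr ▸ h))] at h3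
    exact zero_ne_one h3
  · intro hrec
    have hS := isClosedUnder_reaches π i
    rw [stepMean_congr_of_closed hS (g := fun _ => 1) (fun k hk => ?_) Relation.ReflTransGen.refl,
      stepMean_const]
    exact hittingProb_eq_one hQ hQi hu fun l hl => hrec l (Relation.ReflTransGen.trans hk hl)

end Payoff

/-! ### The Markov chain tree theorem, with trees encoded as maps. -/

section TreeMaps

variable {V : Type*}

/-- Every vertex is eventually mapped to `k` by the iterates of `f`: away from `k`, the map `f` is
a spanning tree rooted at `k`. -/
def IsTreeMap (k : V) (f : V → V) : Prop := ∀ l, ∃ t, f^[t] l = k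

lemma IsTreeMap.congr {k : V} {f f' : V → V} (hf : IsTreeMap k f) (h : ∀ l, l ≠ k → f l = f' l) :
    IsTreeMap k f' := by
  intro l
  obtain ⟨t, ht⟩ := hf l
  induction t generalizing l with
  | zero => exact ⟨0, ht⟩
  | succ t ih =>
    by_cases hl : l = k
    · exact ⟨0, hl⟩
    · obtain ⟨s, hs⟩ := ih (f l) ht
      exact ⟨s + 1, by rw [Function.iterate_succ_apply, ← h l hl, hs]⟩

/-- Some iterate returns `f j` to `j`, so `j` lies on a cycle; `k` is its predecessor there. -/
lemma IsTreeMap.exists_pred {j : V} {f : V → V} (hf : IsTreeMap j f) :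
    ∃ k, IsTreeMap k f ∧ f k = j := by
  obtain ⟨t, ht⟩ := hf (f j)
  refine ⟨f^[t] j, fun l => ?_, ?_⟩
  · obtain ⟨s, hs⟩ := hf l
    exact ⟨t + s, by rw [Function.iterate_add_apply, hs]⟩
  · rw [← Function.iterate_succ_apply' f t j, Function.iterate_succ_apply, ht]

lemma IsTreeMap.of_pred {j k : V} {f : V → V} (hf : IsTreeMap k f) (hk : f k = j) :
    IsTreeMap j f := fun l => by
  obtain ⟨s, hs⟩ := hf l
  exact ⟨s + 1, by rw [Function.iterate_succ_apply', hs, hk]⟩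

lemma IsTreeMap.mem_periodicPts {k : V} {f : V → V} (hf : IsTreeMap k f) :
    k ∈ Function.periodicPts f := by
  obtain ⟨t, ht⟩ := hf (f k)
  exact ⟨t + 1, Nat.succ_pos t, by
    rw [Function.IsPeriodicPt, Function.IsFixedPt, Function.iterate_succ_apply, ht]⟩

/-- Both predecessors are periodic points, on which `f` is injective. -/
lemma IsTreeMap.pred_unique {j k k' : V} {f : V → V} (hf : IsTreeMap k f) (hk : f k = j)
    (hf' : IsTreeMap k' f) (hk' : f k' = j) : k = k' :=
  (Function.bijOn_periodicPts f).injOn hf.mem_periodicPts hf'.mem_periodicPts (hk.trans hk'.symm)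

variable [Fintype V] [DecidableEq V]

open Classical in
/-- The total weight of the spanning trees rooted at `k`, encoded as maps fixing `k`. -/
def treeMapWeight (P : V → V → ℝ) (k : V) : ℝ :=
  ∑ f : V → V with IsTreeMap k f ∧ f k = k, ∏ l ∈ Finset.univ.erase k, P l (f l)

open Classical in
lemma sum_isTreeMap_eq (P : V → V → ℝ) (k j : V) :
    ∑ f : V → V with IsTreeMap k f ∧ f k = j, ∏ l, P l (f l) = treeMapWeight P k * P k j := by
  rw [treeMapWeight, Finset.sum_mul]
  have hcongr : ∀ (f : V → V) (a : V), IsTreeMap k f → IsTreeMap k (Function.update f k a) :=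
    fun f a hf => hf.congr fun l hl => (Function.update_of_ne hl _ _).symm
  refine Finset.sum_nbij' (fun f => Function.update f k k) (fun f => Function.update f k j)
    ?_ ?_ ?_ ?_ ?_
  · intro f hf
    rw [Finset.mem_filter] at hf ⊢
    exact ⟨Finset.mem_univ _, hcongr f k hf.2.1, Function.update_self ..⟩
  · intro f hf
    rw [Finset.mem_filter] at hf ⊢
    exact ⟨Finset.mem_univ _, hcongr f j hf.2.1, Function.update_self ..⟩
  · intro f hf
    rw [Finset.mem_filter] at hf
    simp [← hf.2.2]
  · intro f hf
    rw [Finset.mem_filter] at hf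
    simp only [Function.update_idem]
    have h := Function.update_eq_self k f
    rwa [hf.2.2] at h
  · intro f hf
    rw [Finset.mem_filter] at hf
    rw [← Finset.prod_erase_mul _ _ (Finset.mem_univ k), hf.2.2]
    congr 1
    refine Finset.prod_congr rfl fun l hl => ?_
    rw [Function.update_of_ne (Finset.ne_of_mem_erase hl)]

open Classical in
-- Letting `f k` vary freely multiplies the weight by a row sum, which is 1. Stationarity follows by
-- grouping these maps according to the predecessor of the root on the cycle.
lemma treeMapWeight_eq_sum {P : V → V → ℝ} (hP : ∀ k, ∑ j, P k j = 1) (k : V) :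
    treeMapWeight P k = ∑ f : V → V with IsTreeMap k f, ∏ l, P l (f l) := by
  rw [← Finset.sum_fiberwise _ (fun f : V → V => f k)]
  simp only [Finset.filter_filter, sum_isTreeMap_eq, ← Finset.mul_sum, hP, mul_one]

/-- The **Markov chain tree theorem**: the tree weights are stationary. -/
theorem sum_treeMapWeight_mul {P : V → V → ℝ} (hP : ∀ k, ∑ j, P k j = 1) (j : V) :
    ∑ k, treeMapWeight P k * P k j = treeMapWeight P j := by
  classical
  rw [treeMapWeight_eq_sum hP]
  simp only [← sum_isTreeMap_eq]
  rw [← Finset.sum_biUnion]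
  · refine Finset.sum_congr ?_ fun _ _ => rfl
    ext f
    simp only [Finset.mem_biUnion, Finset.mem_univ, Finset.mem_filter, true_and]
    exact ⟨fun ⟨k, hk, hkj⟩ => hk.of_pred hkj, fun h => h.exists_pred⟩
  · intro k _ k' _ hne
    refine Finset.disjoint_left.mpr fun f hf hf' => hne ?_
    rw [Finset.mem_filter] at hf hf'
    exact hf.2.1.pred_unique hf.2.2 hf'.2.1 hf'.2.2

/-- The weights of all maps add up to the product of the row sums. -/
lemma treeMapWeight_le_one {P : V → V → ℝ} (h0 : ∀ k j, 0 ≤ P k j) (hP : ∀ k, ∑ j, P k j = 1)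
    (k : V) : treeMapWeight P k ≤ 1 := by
  classical
  rw [treeMapWeight_eq_sum hP]
  calc ∑ f : V → V with IsTreeMap k f, ∏ l, P l (f l)
      ≤ ∑ f : V → V, ∏ l, P l (f l) :=
        Finset.sum_le_sum_of_subset_of_nonneg (Finset.filter_subset _ _)
          fun f _ _ => Finset.prod_nonneg fun l _ => h0 _ _
    _ = ∏ l, ∑ j, P l j := (Fintype.prod_sum fun l j => P l j).symm
    _ = 1 := by simp [hP]

lemma treeMapWeight_nonneg {P : V → V → ℝ} (h0 : ∀ k j, 0 ≤ P k j) (k : V) :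
    0 ≤ treeMapWeight P k :=
  Finset.sum_nonneg fun _ _ => Finset.prod_nonneg fun _ _ => h0 _ _

lemma exists_pow_pos {P : V → V → ℝ} (h0 : ∀ k j, 0 ≤ P k j) {l k : V}
    (h : Relation.ReflTransGen (fun a b => 0 < P a b) l k) :
    ∃ t : ℕ, 0 < (Matrix.of P ^ t) l k := by
  have hnn : ∀ (t : ℕ) (a b : V), 0 ≤ (Matrix.of P ^ t) a b := by
    intro t
    induction t with
    | zero =>
      intro a b
      rw [pow_zero, Matrix.one_apply]
      split_ifs <;> norm_num
    | succ t ih =>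
      intro a b
      rw [pow_succ', Matrix.mul_apply]
      exact Finset.sum_nonneg fun c _ => mul_nonneg (h0 a c) (ih c b)
  induction h using Relation.ReflTransGen.head_induction_on with
  | refl => exact ⟨0, by simp⟩
  | @head a b hab _ ih =>
    obtain ⟨t, ht⟩ := ih
    refine ⟨t + 1, ?_⟩
    rw [pow_succ', Matrix.mul_apply]
    exact Finset.sum_pos' (fun c _ => mul_nonneg (h0 a c) (hnn t c k))
      ⟨b, Finset.mem_univ b, mul_pos hab ht⟩

/-- If `k` can be reached from everywhere, there is a spanning tree of positive weight. -/
lemma treeMapWeight_pos {P : V → V → ℝ} (h0 : ∀ k j, 0 ≤ P k j) {k : V}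
    (h : ∀ l, Relation.ReflTransGen (fun a b => 0 < P a b) l k) : 0 < treeMapWeight P k := by
  classical
  have hex := fun l => exists_pow_pos h0 (h l)
  -- The distance to `k` along positive edges; sending each vertex to a strictly closer one yields a
  -- tree.
  set d : V → ℕ := fun l => Nat.find (hex l) with hd
  have hstep : ∀ l, l ≠ k → ∃ a, 0 < P l a ∧ d a < d l := by
    intro l hl
    have hspec := Nat.find_spec (hex l)
    obtain ⟨t, ht⟩ : ∃ t, Nat.find (hex l) = t + 1 := by
      refine Nat.exists_eq_succ_of_ne_zero fun h0 => ?_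
      rw [h0, pow_zero, Matrix.one_apply_ne hl] at hspec
      exact lt_irrefl _ hspec
    rw [ht, pow_succ', Matrix.mul_apply] at hspec
    obtain ⟨a, -, ha⟩ := Finset.exists_lt_of_sum_lt (f := fun _ => (0 : ℝ)) (by simpa using hspec)
    have ha0 : 0 < P l a := (h0 l a).lt_of_ne fun h => by simp [← h] at ha
    refine ⟨a, ha0, ?_⟩
    have : d a ≤ t := Nat.find_min' _ (pos_of_mul_pos_right ha (h0 l a))
    exact this.trans_lt (by rw [hd]; simp only; omega)
  choose! F hF using hstep
  set f : V → V := Function.update F k k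
  have hf : ∀ l, l ≠ k → f l = F l := fun l hl => Function.update_of_ne hl _ _
  have htree : IsTreeMap k f := by
    intro l
    induction hdl : d l using Nat.strong_induction_on generalizing l with
    | _ m ih =>
      by_cases hl : l = k
      · exact ⟨0, hl⟩
      · obtain ⟨t, ht⟩ := ih (d (f l)) (by rw [← hdl, hf l hl]; exact (hF l hl).2) (f l) rfl
        exact ⟨t + 1, ht⟩
  refine Finset.sum_pos' (fun f _ => Finset.prod_nonneg fun l _ => h0 _ _)
    ⟨f, Finset.mem_filter.mpr ⟨Finset.mem_univ _, htree, Function.update_self ..⟩,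
      Finset.prod_pos fun l hl => ?_⟩
  have hl' := Finset.ne_of_mem_erase hl
  rw [hf l hl']
  exact (hF l hl').1

end TreeMaps

/-! ### Edge sets versus maps. -/

section EdgeSets

variable {T : Finset (Fin n)}

/-- The edges of a map, except the one leaving `k`. -/
def edgesOfMap (k : T) (f : T → T) : Finset (Fin n × Fin n) :=
  (Finset.univ.erase k).image fun l : T => (l.1, (f l).1)

lemma mem_edgesOfMap {k : T} {f : T → T} {a b : Fin n} :
    (a, b) ∈ edgesOfMap k f ↔ ∃ l : T, l ≠ k ∧ (l : Fin n) = a ∧ (f l : Fin n) = b := by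
  simp only [edgesOfMap, Finset.mem_image, Finset.mem_erase, Finset.mem_univ, and_true,
    Prod.mk.injEq]

lemma weight_edgesOfMap (π : Profile n) (k : T) (f : T → T) :
    weight π (edgesOfMap k f) = ∏ l ∈ Finset.univ.erase k, π l (f l) := by
  rw [weight, edgesOfMap, Finset.prod_image]
  intro l _ l' _ h
  exact Subtype.ext (Prod.ext_iff.mp h).1

lemma isRootedSpanningTree_edgesOfMap {k : T} {f : T → T} (hf : IsTreeMap k f) :
    IsRootedSpanningTree T k (edgesOfMap k f) where
  root_mem := k.2
  edges_subset := by
    rintro ⟨a, b⟩ hab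
    obtain ⟨l, -, rfl, rfl⟩ := mem_edgesOfMap.mp hab
    exact Finset.mem_product.mpr ⟨l.2, (f l).2⟩
  root_out b hb := by
    obtain ⟨l, hl, hlk, -⟩ := mem_edgesOfMap.mp hb
    exact hl (Subtype.ext hlk)
  out_unique j hj hjk := by
    refine ⟨f ⟨j, hj⟩, mem_edgesOfMap.mpr
      ⟨⟨j, hj⟩, fun h => hjk (congrArg Subtype.val h), rfl, rfl⟩, fun b hb => ?_⟩
    obtain ⟨l, -, hl, rfl⟩ := mem_edgesOfMap.mp hb
    subst hl
    rfl
  acyclic j hj := by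
    classical
    set d : T → ℕ := fun l => Nat.find (hf l) with hd
    have hdec : ∀ l, l ≠ k → d (f l) < d l := by
      intro l hl
      have hspec := Nat.find_spec (hf l)
      obtain ⟨t, ht⟩ : ∃ t, Nat.find (hf l) = t + 1 := by
        refine Nat.exists_eq_succ_of_ne_zero fun h0 => ?_
        rw [h0] at hspec
        exact hl hspec
      rw [ht, Function.iterate_succ_apply] at hspec
      have : d (f l) ≤ t := Nat.find_min' _ hspec
      exact this.trans_lt (by rw [hd]; simp only; omega)
    have hpath : ∀ {a b : Fin n}, Relation.TransGen (fun a b => (a, b) ∈ edgesOfMap k f) a b →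
        ∃ l m : T, (l : Fin n) = a ∧ (m : Fin n) = b ∧ d m < d l := by
      intro a b hab
      induction hab with
      | single h =>
        obtain ⟨l, hl, rfl, rfl⟩ := mem_edgesOfMap.mp h
        exact ⟨l, f l, rfl, rfl, hdec l hl⟩
      | tail _ h ih =>
        obtain ⟨l, hl, rfl, rfl⟩ := mem_edgesOfMap.mp h
        obtain ⟨l', m, hl', hm, hlt⟩ := ih
        obtain rfl := Subtype.ext hm
        exact ⟨l', f m, hl', rfl, (hdec m hl).trans hlt⟩
    obtain ⟨l, m, hl, hm, hlt⟩ := hpath hj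
    obtain rfl : l = m := Subtype.ext (hl.trans hm.symm)
    exact lt_irrefl _ hlt

lemma IsRootedSpanningTree.exists_map {k : T} {τ : Finset (Fin n × Fin n)}
    (hτ : IsRootedSpanningTree T k τ) :
    ∃ f : T → T, (IsTreeMap k f ∧ f k = k) ∧ edgesOfMap k f = τ := by
  classical
  have hex : ∀ l : T, l ≠ k → ∃ m : T, ((l : Fin n), (m : Fin n)) ∈ τ := by
    intro l hl
    obtain ⟨m, hm, -⟩ := hτ.out_unique l l.2 fun h => hl (Subtype.ext h)
    exact ⟨⟨m, (Finset.mem_product.mp (hτ.edges_subset hm)).2⟩, hm⟩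
  choose! F hF using hex
  set f : T → T := Function.update F k k
  have hf : ∀ l : T, l ≠ k → ((l : Fin n), (f l : Fin n)) ∈ τ := fun l hl => by
    rw [show f l = F l from Function.update_of_ne hl _ _]
    exact hF l hl
  refine ⟨f, ⟨fun l => ?_, Function.update_self ..⟩, ?_⟩
  · by_contra! hcon
    have hpath : ∀ s t : ℕ, Relation.TransGen (fun a b => (a, b) ∈ τ)
        (f^[s] l : Fin n) (f^[s + (t + 1)] l : Fin n) := by
      intro s t
      have hedge : ∀ r : ℕ, ((f^[r] l : Fin n), (f^[r + 1] l : Fin n)) ∈ τ := fun r => by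
        rw [Function.iterate_succ_apply']
        exact hf _ (hcon r)
      induction t with
      | zero => exact Relation.TransGen.single (hedge s)
      | succ t ih => exact ih.tail (hedge (s + (t + 1)))
    -- An orbit avoiding the root repeats a vertex, which closes a cycle in `τ`.
    obtain ⟨s, t, hst, heq⟩ := Finite.exists_ne_map_eq_of_infinite fun t : ℕ => f^[t] l
    wlog hlt : s < t generalizing s t
    · exact this t s hst.symm heq.symm (by omega)
    obtain ⟨r, rfl⟩ := Nat.exists_eq_add_of_lt hlt
    have := hpath s r
    rw [← add_assoc, ← heq] at this
    exact hτ.acyclic _ this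
  · ext ⟨a, b⟩
    rw [mem_edgesOfMap]
    constructor
    · rintro ⟨l, hl, rfl, rfl⟩
      exact hf l hl
    · intro hab
      have ha : a ∈ T := (Finset.mem_product.mp (hτ.edges_subset hab)).1
      have hak : a ≠ k := by rintro rfl; exact hτ.root_out b hab
      have hne : (⟨a, ha⟩ : T) ≠ k := fun h => hak (congrArg Subtype.val h)
      exact ⟨⟨a, ha⟩, hne, rfl, (hτ.out_unique a ha hak).unique (hf ⟨a, ha⟩ hne) hab⟩

lemma sum_weight_rootedSpanningTrees (π : Profile n) (k : T) :
    ∑ τ ∈ rootedSpanningTrees T k, weight π τ = treeMapWeight (fun a b : T => π a b) k := by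
  classical
  symm
  refine Finset.sum_bij (fun f _ => edgesOfMap k f) ?_ ?_ ?_ ?_
  · intro f hf
    rw [Finset.mem_filter] at hf
    exact Finset.mem_filter.mpr ⟨Finset.mem_univ _, isRootedSpanningTree_edgesOfMap hf.2.1⟩
  · intro f hf f' hf' heq
    rw [Finset.mem_filter] at hf hf'
    funext l
    by_cases hl : l = k
    · rw [hl, hf.2.2, hf'.2.2]
    · have h1 : ((l : Fin n), (f l : Fin n)) ∈ edgesOfMap k f' :=
        heq ▸ mem_edgesOfMap.mpr ⟨l, hl, rfl, rfl⟩
      obtain ⟨m, -, hm, hfm⟩ := mem_edgesOfMap.mp h1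
      obtain rfl := Subtype.ext hm
      exact Subtype.ext hfm.symm
  · intro τ hτ
    obtain ⟨f, hf, rfl⟩ := (Finset.mem_filter.mp hτ).2.exists_map
    exact ⟨f, Finset.mem_filter.mpr ⟨Finset.mem_univ _, hf⟩, rfl⟩
  · intro f _
    exact (weight_edgesOfMap π k f).symm

lemma treeWeight_eq_sum (π : Profile n) (T : Finset (Fin n)) :
    treeWeight π T = ∑ k : T, treeMapWeight (fun a b : T => π a b) k := by
  rw [treeWeight, ← Finset.sum_coe_sort]
  exact Finset.sum_congr rfl fun k _ => sum_weight_rootedSpanningTrees π k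

end EdgeSets

/-! ### Tree weights on closed sets. -/

section ClosedSets

variable {π : Profile n} {T : Finset (Fin n)}

lemma stepMean_eq_sum_of_closed (hT : IsClosedUnder π (T : Set (Fin n))) (f : Fin n → ℝ) (k : T) :
    stepMean π f k = ∑ l : T, π k l * f l := by
  rw [stepMean_apply, Finset.sum_coe_sort T (fun l => π k l * f l)]
  refine (Finset.sum_subset (Finset.subset_univ T) fun l _ hl => ?_).symm
  rw [prob_eq_zero_of_notMem hT k.2 hl, zero_mul]

lemma sum_prob_of_closed (hT : IsClosedUnder π (T : Set (Fin n))) (k : T) :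
    ∑ l : T, π k l = 1 := by
  have := stepMean_eq_sum_of_closed hT (fun _ => 1) k
  simpa [stepMean_const] using this.symm

lemma Reaches.restrict (hT : IsClosedUnder π (T : Set (Fin n))) {l k : T}
    (h : Reaches π l k) : Relation.ReflTransGen (fun a b : T => 0 < π a b) l k := by
  have key : ∀ c, Reaches π l c →
      ∃ hc : c ∈ T, Relation.ReflTransGen (fun a b : T => 0 < π a b) l ⟨c, hc⟩ := by
    intro c hc
    induction hc with
    | refl => exact ⟨l.2, Relation.ReflTransGen.refl⟩
    | @tail b c _ hbc ih =>
      obtain ⟨hb, hlb⟩ := ih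
      exact ⟨hT b hb c hbc, hlb.tail hbc⟩
  exact (key k h).2

lemma treeWeight_le_card (hT : IsClosedUnder π (T : Set (Fin n))) :
    treeWeight π T ≤ T.card := by
  rw [treeWeight_eq_sum]
  refine (Finset.sum_le_card_nsmul _ _ 1 fun k _ => treeMapWeight_le_one
    (fun a b => prob_nonneg _ _) (sum_prob_of_closed hT) k).trans ?_
  simp

lemma treeMapWeight_restrict_pos (hT : IsClosedUnder π (T : Set (Fin n))) {k : T}
    (hk : ∀ l ∈ T, Reaches π l k) : 0 < treeMapWeight (fun a b : T => π a b) k :=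
  treeMapWeight_pos (fun _ _ => prob_nonneg _ _) fun l => Reaches.restrict hT (hk l l.2)

lemma treeWeight_pos (hT : IsClosedUnder π (T : Set (Fin n))) {k : Fin n} (hkT : k ∈ T)
    (hk : ∀ l ∈ T, Reaches π l k) : 0 < treeWeight π T := by
  rw [treeWeight_eq_sum]
  exact Finset.sum_pos' (fun l _ => treeMapWeight_nonneg (fun _ _ => prob_nonneg _ _) l)
    ⟨⟨k, hkT⟩, Finset.mem_univ _, treeMapWeight_restrict_pos hT hk⟩

lemma treeWeight_congr {π' : Profile n} (h : ∀ k ∈ T, π k = π' k) :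
    treeWeight π T = treeWeight π' T := by
  have : (fun a b : T => π a b) = fun a b : T => π' a b := by
    funext a b
    rw [h a a.2]
  rw [treeWeight_eq_sum, treeWeight_eq_sum, this]

lemma sum_weight_rootedSpanningTrees_congr {π' : Profile n} {i : Fin n}
    (h : ∀ k, k ≠ i → π k = π' k) (T : Finset (Fin n)) :
    ∑ τ ∈ rootedSpanningTrees T i, weight π τ = ∑ τ ∈ rootedSpanningTrees T i, weight π' τ := by
  classical
  refine Finset.sum_congr rfl fun τ hτ => Finset.prod_congr rfl fun e he => ?_
  have hne : e.1 ≠ i := fun hei => (Finset.mem_filter.mp hτ).2.root_out e.2 (hei ▸ he)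
  rw [h _ hne]

/-- The total tree weight is the mean return time to `i` times the weight of the trees rooted
at `i`. -/
lemma returnTime_mul_treeMapWeight {Q : Profile n} {i : Fin n} {u g : Fin n → ℝ}
    (hT : IsClosedUnder π (T : Set (Fin n))) (hi : i ∈ T) (hQ : ∀ k, k ≠ i → π k = Q k)
    (hu : IsHittingProb Q {i} u) (hg : Pi.single i 1 - u = g - stepMean Q g)
    (huT : ∀ k ∈ T, u k = 1) :
    returnTime π i g * ∑ τ ∈ rootedSpanningTrees T i, weight π τ = treeWeight π T := by
  rw [sum_weight_rootedSpanningTrees π ⟨i, hi⟩]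
  set P : T → T → ℝ := fun a b => π a b with hP
  -- A stationary vector annihilates coboundaries; on `T` this coboundary is the return time times
  -- the indicator of `i`, minus 1.
  have hstat : ∑ k : T, treeMapWeight P k * (g k - stepMean π g k) = 0 := by
    simp only [mul_sub, Finset.sum_sub_distrib, stepMean_eq_sum_of_closed hT, Finset.mul_sum]
    rw [Finset.sum_comm, sub_eq_zero]
    refine Finset.sum_congr rfl fun l _ => ?_
    rw [← sum_treeMapWeight_mul (sum_prob_of_closed hT) l, Finset.sum_mul]
    exact Finset.sum_congr rfl fun k _ => by ring
  have hpt : ∀ k : T, g k - stepMean π g k =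
      returnTime π i g * (if k = ⟨i, hi⟩ then 1 else 0) - 1 := by
    intro k
    rw [poisson_returnTime hQ hu hg, huT k k.2]
    simp [Pi.single_apply, Subtype.ext_iff]
  simp only [hpt, mul_sub, Finset.sum_sub_distrib, mul_one] at hstat
  rw [treeWeight_eq_sum]
  simp only [mul_ite, mul_one, mul_zero, Finset.sum_ite_eq', Finset.mem_univ, if_true] at hstat
  linarith

end ClosedSets

/-! ### Recurrent classes and their transient closures. -/

section Classes

variable {π : Profile n} {R R' : Finset (Fin n)}

lemma mem_recurrentClasses : R ∈ recurrentClasses π ↔ IsRecurrentClass π R := by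
  simp [recurrentClasses]

lemma IsRecurrentClass.isClosedUnder (hR : IsRecurrentClass π R) :
    IsClosedUnder π (R : Set (Fin n)) :=
  fun k hk l hl => (hR.2 k hk l).mp (Relation.ReflTransGen.single hl)

lemma IsRecurrentClass.mem_transientClosure (hR : IsRecurrentClass π R) {j : Fin n} :
    j ∈ transientClosure π R ↔ ∀ k, Reaches π j k → ∃ r ∈ R, Reaches π k r := by
  rw [← absorptionProb_eq_one_iff hR.isClosedUnder, transientClosure]
  simp

lemma IsRecurrentClass.subset_transientClosure (hR : IsRecurrentClass π R) :
    R ⊆ transientClosure π R := fun j hj =>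
  hR.mem_transientClosure.mpr fun k hk => ⟨k, (hR.2 j hj k).mp hk, Relation.ReflTransGen.refl⟩

lemma IsRecurrentClass.isClosedUnder_transientClosure (hR : IsRecurrentClass π R) :
    IsClosedUnder π (transientClosure π R : Set (Fin n)) := fun _ hk _ hl =>
  hR.mem_transientClosure.mpr fun m hm =>
    hR.mem_transientClosure.mp hk m (Relation.ReflTransGen.head hl hm)

lemma IsRecurrentClass.reaches_of_mem_transientClosure (hR : IsRecurrentClass π R) {j r : Fin n}
    (hj : j ∈ transientClosure π R) (hr : r ∈ R) : Reaches π j r := by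
  obtain ⟨s, hs, hjs⟩ := hR.mem_transientClosure.mp hj j Relation.ReflTransGen.refl
  exact hjs.trans ((hR.2 s hs r).mpr hr)

lemma IsRecurrentClass.eq_of_mem (hR : IsRecurrentClass π R) (hR' : IsRecurrentClass π R')
    {j : Fin n} (hj : j ∈ R) (hj' : j ∈ R') : R = R' := by
  ext k
  rw [← hR.2 j hj, hR'.2 j hj']

lemma IsRecurrentClass.isRecurrent (hR : IsRecurrentClass π R) {j : Fin n} (hj : j ∈ R) :
    IsRecurrent π j := fun k hk => (hR.2 k ((hR.2 j hj k).mp hk) j).mpr hj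

lemma IsRecurrentClass.disjoint_transientClosure (hR : IsRecurrentClass π R)
    (hR' : IsRecurrentClass π R') (hne : R ≠ R') :
    Disjoint (transientClosure π R) (transientClosure π R') := by
  refine Finset.disjoint_left.mpr fun j hj hj' => hne ?_
  obtain ⟨r, hr⟩ := hR.1
  obtain ⟨r', hr', hrr'⟩ := hR'.mem_transientClosure.mp hj' r
    (hR.reaches_of_mem_transientClosure hj hr)
  exact hR.eq_of_mem hR' ((hR.2 r hr r').mp hrr') hr'

lemma IsRecurrentClass.mem_of_mem_transientClosure (hR : IsRecurrentClass π R) {i : Fin n}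
    (hi : IsRecurrent π i) (hiR : i ∈ transientClosure π R) : i ∈ R := by
  obtain ⟨r, hr⟩ := hR.1
  have hir := hR.reaches_of_mem_transientClosure hiR hr
  exact (hR.2 r hr i).mp (hi r hir)

lemma IsRecurrentClass.treeWeight_pos (hR : IsRecurrentClass π R) :
    0 < treeWeight π (transientClosure π R) := by
  obtain ⟨r, hr⟩ := hR.1
  exact BuckHolding.treeWeight_pos hR.isClosedUnder_transientClosure
    (hR.subset_transientClosure hr) fun l hl => hR.reaches_of_mem_transientClosure hl hr

open Classical in
/-- The set of vertices which can be reached from `i`. -/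
def reachableSet (π : Profile n) (i : Fin n) : Finset (Fin n) :=
  Finset.univ.filter (Reaches π i)

lemma mem_reachableSet {i k : Fin n} : k ∈ reachableSet π i ↔ Reaches π i k := by
  simp [reachableSet]

lemma IsRecurrent.isRecurrentClass {i : Fin n} (hi : IsRecurrent π i) :
    IsRecurrentClass π (reachableSet π i) :=
  ⟨⟨i, mem_reachableSet.mpr Relation.ReflTransGen.refl⟩, fun j hj k => by
    rw [mem_reachableSet] at hj ⊢
    exact ⟨fun h => hj.trans h, fun h => (hi j hj).trans h⟩⟩

lemma self_mem_reachableSet (π : Profile n) (i : Fin n) : i ∈ reachableSet π i :=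
  mem_reachableSet.mpr Relation.ReflTransGen.refl

/-- A vertex with a smallest reachable set is recurrent; `i` only witnesses that vertices exist. -/
lemma exists_isRecurrent (π : Profile n) (i : Fin n) : ∃ j, IsRecurrent π j := by
  obtain ⟨j, -, hmin⟩ := Finset.exists_min_image Finset.univ (fun j => (reachableSet π j).card)
    ⟨i, Finset.mem_univ i⟩
  refine ⟨j, fun k hk => ?_⟩
  have hsub : reachableSet π k ⊆ reachableSet π j := fun l hl =>
    mem_reachableSet.mpr (hk.trans (mem_reachableSet.mp hl))
  have := Finset.eq_of_subset_of_card_le hsub (hmin k (Finset.mem_univ k))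
  exact mem_reachableSet.mp (this ▸ self_mem_reachableSet π j)

open Classical in
/-- The recurrent classes which do not contain `i`. -/
def otherClasses (π : Profile n) (i : Fin n) : Finset (Finset (Fin n)) :=
  (recurrentClasses π).filter fun R => i ∉ R

lemma mem_otherClasses {i : Fin n} : R ∈ otherClasses π i ↔ IsRecurrentClass π R ∧ i ∉ R := by
  rw [otherClasses, Finset.mem_filter, mem_recurrentClasses]

/-- The contribution of a recurrent class to the potential. -/
def classTerm (π : Profile n) (R : Finset (Fin n)) : ℝ :=
  (n : ℝ) - treeWeight π (transientClosure π R)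

lemma potential_of_isRecurrent {i : Fin n} (hi : IsRecurrent π i) :
    potential π = classTerm π (reachableSet π i) + ∑ R ∈ otherClasses π i, classTerm π R := by
  classical
  have hnot : reachableSet π i ∉ otherClasses π i := fun h =>
    (mem_otherClasses.mp h).2 (self_mem_reachableSet π i)
  rw [← Finset.sum_insert hnot, potential]
  refine Finset.sum_congr ?_ fun _ _ => rfl
  ext R
  rw [mem_recurrentClasses, Finset.mem_insert, mem_otherClasses]
  constructor
  · intro hR
    by_cases hiR : i ∈ R
    · exact Or.inl (hR.eq_of_mem hi.isRecurrentClass hiR (self_mem_reachableSet π i))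
    · exact Or.inr ⟨hR, hiR⟩
  · rintro (rfl | h)
    · exact hi.isRecurrentClass
    · exact h.1

lemma potential_of_not_isRecurrent {i : Fin n} (hi : ¬ IsRecurrent π i) :
    potential π = ∑ R ∈ otherClasses π i, classTerm π R := by
  refine Finset.sum_congr ?_ fun _ _ => rfl
  ext R
  rw [mem_recurrentClasses, mem_otherClasses]
  exact ⟨fun hR => ⟨hR, fun hiR => hi (hR.isRecurrent hiR)⟩, fun h => h.1⟩

end Classes

/-! ### How the potential changes when one row changes. -/

section Deviation

variable {π π' : Profile n} {i : Fin n} {R : Finset (Fin n)}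

lemma IsRecurrentClass.of_agree (h : ∀ k, k ≠ i → π k = π' k) (hR : IsRecurrentClass π R)
    (hi : i ∉ R) : IsRecurrentClass π' R :=
  ⟨hR.1, fun j hj k => by
    rw [← reaches_iff_of_agree_of_not_reaches h (fun hji => hi ((hR.2 j hj i).mp hji)) k, hR.2 j hj]⟩

lemma otherClasses_eq (h : ∀ k, k ≠ i → π k = π' k) : otherClasses π i = otherClasses π' i := by
  ext R
  rw [mem_otherClasses, mem_otherClasses]
  exact ⟨fun ⟨hR, hi⟩ => ⟨hR.of_agree h hi, hi⟩,
    fun ⟨hR, hi⟩ => ⟨hR.of_agree (fun k hk => (h k hk).symm) hi, hi⟩⟩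

/-- The closure is a closed set, so no path from it meets `i` and the new row is invisible there. -/
lemma transientClosure_subset_of_agree (h : ∀ k, k ≠ i → π k = π' k) (hR : IsRecurrentClass π R)
    (hi : i ∉ transientClosure π R) : transientClosure π R ⊆ transientClosure π' R := by
  intro j hj
  have hnot : ∀ {k}, Reaches π j k → ¬ Reaches π k i := fun hjk hki =>
    hi (hR.isClosedUnder_transientClosure.mem_of_reaches hj (hjk.trans hki))
  have hR' : IsRecurrentClass π' R := hR.of_agree h fun hiR => hi (hR.subset_transientClosure hiR)
  refine hR'.mem_transientClosure.mpr fun k hk => ?_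
  rw [← reaches_iff_of_agree_of_not_reaches h (hnot Relation.ReflTransGen.refl)] at hk
  obtain ⟨r, hr, hkr⟩ := hR.mem_transientClosure.mp hj k hk
  exact ⟨r, hr, hkr.of_agree_of_not_reaches h (hnot hk)⟩

lemma classTerm_eq_of_agree (h : ∀ k, k ≠ i → π k = π' k) (hR : IsRecurrentClass π R)
    (hi : i ∉ transientClosure π R) (hi' : i ∉ transientClosure π' R) :
    classTerm π R = classTerm π' R := by
  have hR' : IsRecurrentClass π' R := hR.of_agree h fun hiR => hi (hR.subset_transientClosure hiR)
  have heq : transientClosure π R = transientClosure π' R :=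
    (transientClosure_subset_of_agree h hR hi).antisymm
      (transientClosure_subset_of_agree (fun k hk => (h k hk).symm) hR' hi')
  rw [classTerm, classTerm, ← heq,
    treeWeight_congr fun k hk => h k fun hki => hi (by rwa [hki] at hk)]

lemma mem_transientClosure_reachableSet (hi : IsRecurrent π i) {j : Fin n} :
    j ∈ transientClosure π (reachableSet π i) ↔ ∀ k, Reaches π j k → Reaches π k i := by
  rw [hi.isRecurrentClass.mem_transientClosure]
  refine forall₂_congr fun k _ => ⟨?_, fun h => ⟨i, self_mem_reachableSet π i, h⟩⟩
  rintro ⟨r, hr, hkr⟩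
  exact hkr.trans (hi r (mem_reachableSet.mp hr))

lemma transientClosure_reachableSet_subset (h : ∀ k, k ≠ i → π k = π' k) (hi : IsRecurrent π i)
    (hi' : IsRecurrent π' i) :
    transientClosure π (reachableSet π i) ⊆ transientClosure π' (reachableSet π' i) := by
  intro j hj
  rw [mem_transientClosure_reachableSet hi] at hj
  rw [mem_transientClosure_reachableSet hi']
  intro k hk
  -- A `π'`-path from `j` either is also a `π`-path or has passed through `i`.
  have key : Reaches π j k ∨ Reaches π' i k := by
    induction hk with
    | refl => exact Or.inl Relation.ReflTransGen.refl
    | @tail b c _ hbc ih =>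
      rcases ih with ih | ih
      · by_cases hb : b = i
        · exact Or.inr (Relation.ReflTransGen.single (hb ▸ hbc))
        · exact Or.inl (ih.tail (by rwa [h b hb]))
      · exact Or.inr (ih.tail hbc)
  rcases key with hjk | hik
  · exact (hj k hjk).of_agree h
  · exact hi' k hik

/-- If `i` becomes recurrent, the potential increases. -/
lemma potential_lt_of_becomes_recurrent (h : ∀ k, k ≠ i → π k = π' k) (hi : ¬ IsRecurrent π i)
    (hi' : IsRecurrent π' i) : potential π < potential π' := by
  classical
  rw [potential_of_not_isRecurrent hi, potential_of_isRecurrent hi', ← otherClasses_eq h]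
  set C := reachableSet π' i
  have hC := hi'.isRecurrentClass
  have hother : ∀ R ∈ otherClasses π i, IsRecurrentClass π R ∧ IsRecurrentClass π' R ∧
      i ∉ transientClosure π' R := by
    intro R hR
    obtain ⟨hRπ, hiR⟩ := mem_otherClasses.mp hR
    have hR' := hRπ.of_agree h hiR
    exact ⟨hRπ, hR', fun hcl => hiR (hR'.mem_of_mem_transientClosure hi' hcl)⟩
  -- Closures are disjoint, so at most one contains `i`. If none does, any old class serves as `R`.
  obtain ⟨R, hR, hrest⟩ : ∃ R ∈ otherClasses π i, ∀ S ∈ otherClasses π i, S ≠ R →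
      i ∉ transientClosure π S := by
    by_cases hex : ∃ R ∈ otherClasses π i, i ∈ transientClosure π R
    · obtain ⟨R, hR, hiR⟩ := hex
      exact ⟨R, hR, fun S hS hne hiS => Finset.disjoint_left.mp
        ((hother S hS).1.disjoint_transientClosure (hother R hR).1 hne) hiS hiR⟩
    · push Not at hex
      obtain ⟨j, hj⟩ := exists_isRecurrent π i
      refine ⟨reachableSet π j, mem_otherClasses.mpr ⟨hj.isRecurrentClass, fun hij =>
        hi (hj.isRecurrentClass.isRecurrent hij)⟩, fun S hS _ => hex S hS⟩
  obtain ⟨hRπ, hR', hiR'⟩ := hother R hR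
  have hsum : ∑ S ∈ (otherClasses π i).erase R, classTerm π S =
      ∑ S ∈ (otherClasses π i).erase R, classTerm π' S :=
    Finset.sum_congr rfl fun S hS => by
      obtain ⟨hne, hS⟩ := Finset.mem_erase.mp hS
      obtain ⟨hSπ, -, hiS'⟩ := hother S hS
      exact classTerm_eq_of_agree h hSπ (hrest S hS hne) hiS'
  rw [← Finset.add_sum_erase _ _ hR, ← Finset.add_sum_erase _ (classTerm π') hR, hsum]
  have hne : C ≠ R := fun heq => (mem_otherClasses.mp hR).2 (heq ▸ self_mem_reachableSet π' i)
  have hcard : ((transientClosure π' C).card : ℝ) + (transientClosure π' R).card ≤ n := by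
    rw [← Nat.cast_add, ← Finset.card_union_of_disjoint (hC.disjoint_transientClosure hR' hne)]
    exact_mod_cast (Finset.card_le_univ _).trans_eq (Fintype.card_fin n)
  have h1 := treeWeight_le_card hC.isClosedUnder_transientClosure
  have h2 := treeWeight_le_card hR'.isClosedUnder_transientClosure
  have h3 := hRπ.treeWeight_pos
  simp only [classTerm]
  -- `n - Ω(R) < n ≤ (n - Ω'(C)) + (n - Ω'(R))`, with `Ω` and `Ω'` taken in `π` and `π'`.
  linarith

end Deviation

/-! ### Conclusion: profitable deviations. -/

/-- Every profitable deviation of a single player increases the potential. -/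
theorem potential_lt_of_payoff_lt {μ : stdSimplex ℝ (Fin n)} (hμ : ∀ i, 0 < μ i)
    {π π' : Profile n} {i : Fin n} (h : ∀ k, k ≠ i → π k = π' k)
    (hlt : payoff μ i π < payoff μ i π') : potential π < potential π' := by
  set Q : Profile n := Function.update π i (stdSimplex.vertex i)
  have hQi : Q i = stdSimplex.vertex i := Function.update_self ..
  have hQ : ∀ k, k ≠ i → π k = Q k := fun k hk => (Function.update_of_ne hk _ _).symm
  have hQ' : ∀ k, k ≠ i → π' k = Q k := fun k hk => (h k hk).symm.trans (hQ k hk)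
  obtain ⟨u, g, hu, hg⟩ := exists_hittingProb (isClosedUnder_singleton hQi)
  have hg' : Pi.single i 1 - u = g - stepMean Q g := by
    rw [← hg]
    congr 1
    funext k
    simp [Set.indicator_apply, Pi.single_apply]
  have hA := sum_mul_hittingProb_pos hμ hu
  have hzero : ∀ {ρ : Profile n}, (∀ k, k ≠ i → ρ k = Q k) → ¬ IsRecurrent ρ i →
      payoff μ i ρ = 0 := fun hρ hi => payoff_eq_zero μ hρ hu
    ((stepMean_le_one hu).lt_of_ne (mt (stepMean_eq_one_iff hρ hQi hu).mp hi))
  have hrec : ∀ {ρ : Profile n} (hρ : ∀ k, k ≠ i → ρ k = Q k) (hi : IsRecurrent ρ i),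
      0 < ∑ τ ∈ rootedSpanningTrees (transientClosure ρ (reachableSet ρ i)) i, weight ρ τ ∧
        returnTime ρ i g *
          ∑ τ ∈ rootedSpanningTrees (transientClosure ρ (reachableSet ρ i)) i, weight ρ τ =
          treeWeight ρ (transientClosure ρ (reachableSet ρ i)) ∧
        0 < returnTime ρ i g ∧ payoff μ i ρ = (∑ j, μ j * u j) / returnTime ρ i g := by
    intro ρ hρ hi
    have hC := hi.isRecurrentClass
    have hiT := hC.subset_transientClosure (self_mem_reachableSet ρ i)
    have hw := treeMapWeight_restrict_pos (k := ⟨i, hiT⟩) hC.isClosedUnder_transientClosure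
      fun l hl => hC.reaches_of_mem_transientClosure hl (self_mem_reachableSet ρ i)
    rw [← sum_weight_rootedSpanningTrees ρ ⟨i, hiT⟩] at hw
    have hm := returnTime_mul_treeMapWeight hC.isClosedUnder_transientClosure hiT hρ hu hg'
      fun k hk => hittingProb_eq_one hρ hQi hu ((mem_transientClosure_reachableSet hi).mp hk)
    have hpos : 0 < returnTime ρ i g := pos_of_mul_pos_left (hm ▸ hC.treeWeight_pos) hw.le
    exact ⟨hw, hm, hpos, payoff_eq_div μ hρ hu hg'
      ((stepMean_eq_one_iff hρ hQi hu).mpr hi) hpos.ne'⟩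
  by_cases hi' : IsRecurrent π' i
  · by_cases hi : IsRecurrent π i
    · have hsymm : ∀ k, k ≠ i → π' k = π k := fun k hk => (h k hk).symm
      have heq : transientClosure π (reachableSet π i) = transientClosure π' (reachableSet π' i) :=
        (transientClosure_reachableSet_subset h hi hi').antisymm
          (transientClosure_reachableSet_subset hsymm hi' hi)
      obtain ⟨hw, hm, hpos, hpay⟩ := hrec hQ hi
      obtain ⟨-, hm', hpos', hpay'⟩ := hrec hQ' hi'
      have hother : ∑ R ∈ otherClasses π i, classTerm π R =
          ∑ R ∈ otherClasses π' i, classTerm π' R := by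
        rw [← otherClasses_eq h]
        refine Finset.sum_congr rfl fun R hR => ?_
        obtain ⟨hRπ, hiR⟩ := mem_otherClasses.mp hR
        exact classTerm_eq_of_agree h hRπ (fun hcl => hiR (hRπ.mem_of_mem_transientClosure hi hcl))
          fun hcl => hiR ((hRπ.of_agree h hiR).mem_of_mem_transientClosure hi' hcl)
      rw [potential_of_isRecurrent hi, potential_of_isRecurrent hi', hother, classTerm, classTerm]
      -- The numerators agree, so a larger payoff means a shorter return time; multiplying by the
      -- common weight of the trees rooted at `i` compares the tree weights.
      rw [hpay, hpay', div_lt_div_iff_of_pos_left hA hpos hpos'] at hlt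
      rw [← heq, sum_weight_rootedSpanningTrees_congr hsymm] at hm'
      rw [← heq, ← hm, ← hm']
      have := mul_lt_mul_of_pos_right hlt hw
      linarith
    · exact potential_lt_of_becomes_recurrent h hi hi'
  · rw [hzero hQ' hi'] at hlt
    by_cases hi : IsRecurrent π i
    · obtain ⟨-, -, hpos, hpay⟩ := hrec hQ hi
      rw [hpay] at hlt
      exact absurd hlt (div_pos hA hpos).not_gt
    · rw [hzero hQ hi] at hlt
      exact absurd hlt (lt_irrefl 0)

end BuckHolding

end

theorem mainTheorem11 (n : ℕ) (G : Digraph (Fin n)) (μ : stdSimplex ℝ (Fin n))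
    (hμ : ∀ i, 0 < μ i) (Ξ : Fin n → Set (stdSimplex ℝ (Fin n)))
    (hΞ : ∀ i, ∀ p ∈ Ξ i, ∀ j, ¬ G.Adj i j → p j = 0) :
    BuckHolding.IsGeneralizedOrdinalPotential (S := fun i => ↥(Ξ i))
      (fun i s => BuckHolding.payoff μ i fun k => (s k : stdSimplex ℝ (Fin n)))
      (fun s => BuckHolding.potential fun k => (s k : stdSimplex ℝ (Fin n))) := by
  intro s i s' hlt
  exact BuckHolding.potential_lt_of_payoff_lt hμ
    (fun k hk => by rw [Function.update_of_ne hk]) hlt
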